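/- Let $D\ge 2$, $n$ and $0\le l_{\min}\le l_{\max}$ be integers, let $p_1,\dots,p_{n}\ge 0$, and let $\varphi:[0,\infty)\to\mathbb R$ be convex and monotonically increasing. Let $d\in\{0,\dots,D-2\}$ be the number with $n+d\equiv 1 \pmod{D-1}$, put $n'=n+d$ and $p_i=0$ for $n<i\le n'$ (dummy symbols), and assume $n\le D^{l_{\max}}$ and $n'\ge D^{l_{\min}}$. For $m\in\{n,n'\}$, the bounded-length $D$-ary coding problem for $p_1,\dots,p_m$ asks to minimize $\sum_{i=1}^m p_i\varphi(l_i-l_{\min})$ over the length vectors $l\in\{l_{\min},\dots,l_{\max}\}^m$ with $\sum_{i=1}^m D^{-l_i}\le 1$. A node is a pair $(i,l)$ with $1\le i\le n'$ and $l_{\min}+1\le l\le l_{\max}$; it has width $D^{-l}$ and weight $\mu(i,l)=p_i\varphi(l-l_{\min})-p_i\varphi(l-l_{\min}-1)$. Let $I$ be the set of all nodes, numbered by distinct integers in any way, and for a length vector $l$ let $\eta(l)=\{(i,k): 1\le i\le n',\ l_{\min}+1\le k\le l_i\}$. The Coin Collector's problem for a finite set $\mathcal I$ of items with widths in $D^{\mathbb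 Z}$ and real weights, and a total width $\rho$, asks for a subset of $\mathcal I$ of total width exactly $\rho$ and of least total weight. The Package-Merge procedure $\mathrm{CC}(\mathcal I,\rho)$ is the following recursion. If $\rho=0$, the result is $\emptyset$. Otherwise, let $\rho_{\mathrm{pow}}$ be the power of $D$ for which $\rho/\rho_{\mathrm{pow}}$ is an integer not divisible by $D$, let $\rho^*$ be the least width in $\mathcal I\neq\emptyset$ and $\mathcal I^*$ the set of items of width $\rho^*$, ordered by increasing weight with ties broken in favour of the higher index. (1) If $\rho^*=\rho_{\mathrm{pow}}$, the result is $\mathrm{CC}(\mathcal I\setminus\{i^*\},\rho-\rho^*)\cup\{i^*\}$, where $i^*$ is the first item of $\mathcal I^*$. (2a) If $\rho^*<\rho_{\mathrm{pow}}$ and $|\mathcal I^*|<D$, the result is $\mathrm{CC}(\mathcal I\setminus\mathcal I^*,\rho)$. (2b) If $\rho^*<\rho_{\mathrm{pow}}$ and $|\mathcal I^*|\ge D$, let $\mathcal P^*$ be the set of the first $D$ items of $\mathcal I^*$, let $i'$ be a new item of width $D\rho^*$, of weight the sum of the weights in $\mathcal P^*$, and of index lower than all indices in $\mathcal I$, and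 let $\mathcal S=\mathrm{CC}((\mathcal I\setminus\mathcal P^*)\cup\{i'\},\rho)$; the result is $(\mathcal S\setminus\{i'\})\cup\mathcal P^*$ if $i'\in\mathcal S$, and $\mathcal S$ otherwise. Theorem. Run Package-Merge on $\mathcal I=I$ with total width $$\rho_{\mathrm{total}}=\frac{n'-D^{l_{\min}}}{D-1}\,D^{-l_{\min}}.$$ It terminates with a set $N\subseteq I$ that is an optimal solution of this Coin Collector's problem, and there is a length vector $l^N\in\{l_{\min},\dots,l_{\max}\}^{n'}$ with $N=\eta(l^N)$. Moreover $$\sum_{(i,l)\in N}\mu(i,l)=\min_{l}\ \sum_{i=1}^{n'} p_i\varphi(l_i-l_{\min})-\varphi(0)\sum_{i=1}^{n'}p_i ,$$ where the minimum is over all $l\in\{l_{\min},\dots,l_{\max}\}^{n'}$ with $\sum_i D^{-l_i}\le 1$. The vector $l^N$ solves the bounded-length coding problem for $p_1,\dots,p_{n'}$, and $(l^N_1,\dots,l^N_n)$ solves it for the original $p_1,\dots,p_n$. Thus the bounded-length coding problem reduces to the Coin Collector's problem. -/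

import Mathlib

noncomputable section

namespace BoundedCoding

/-! ### The `D`-ary Coin Collector's problem -/

/-- A coin (item): an index, a width (face value) and a weight. -/
@[ext]
structure Item where
  index : ℤ
  width : ℝ
  weight : ℝ

instance : DecidableEq Item := Classical.decEq _

/-- Total width of a collection of items. -/
def totalWidth (S : Finset Item) : ℝ := ∑ a ∈ S, a.width

/-- Total weight of a collection of items. -/
def totalWeight (S : Finset Item) : ℝ := ∑ a ∈ S, a.weight

/-- `B` is an optimal solution of the Coin Collector's problem with items `I` and total width
`total`: among the subsets of `I` of total width exactly `total`, it has least total weight. -/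
def IsCoinSolution (I : Finset Item) (total : ℝ) (B : Finset Item) : Prop :=
  B ⊆ I ∧ totalWidth B = total ∧
    ∀ B' ⊆ I, totalWidth B' = total → totalWeight B ≤ totalWeight B'

/-! ### The recursive `D`-ary Package-Merge procedure -/

/-- `x` is the remainder of `total`: the (unique) integer power of `D` such that `total / x` is an
integer that is not a multiple of `D`. -/
def IsRemainder (D : ℕ) (total x : ℝ) : Prop :=
  (∃ k : ℤ, x = (D : ℝ) ^ k) ∧ ∃ z : ℤ, total / x = z ∧ ¬ (D : ℤ) ∣ z

/-- The remainder is unique. -/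
theorem IsRemainder.unique {D : ℕ} (hD : 2 ≤ D) {total x y : ℝ}
    (hx : IsRemainder D total x) (hy : IsRemainder D total y) : x = y := by
  have hD0 : (D : ℝ) ≠ 0 := by positivity
  have key : ∀ (a b z w : ℤ), a < b → total / (D : ℝ) ^ a = z → total / (D : ℝ) ^ b = w →
      (D : ℤ) ∣ z := by
    intro a b z w hab hz hw
    obtain ⟨m, hm⟩ := Int.eq_ofNat_of_zero_le (sub_nonneg.2 (Int.add_one_le_iff.2 hab))
    have hb : b = a + ((m + 1 : ℕ) : ℤ) := by push_cast; omega
    have ha : (D : ℝ) ^ a ≠ 0 := zpow_ne_zero _ hD0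
    have h1 : (z : ℝ) = w * (D : ℝ) ^ (m + 1) := by
      rw [← hz, ← hw, hb, zpow_add₀ hD0, zpow_natCast]
      field_simp
    have h2 : z = w * (D : ℤ) ^ (m + 1) := by exact_mod_cast h1
    rw [h2, pow_succ]
    exact ⟨w * (D : ℤ) ^ m, by ring⟩
  obtain ⟨⟨a, rfl⟩, z, hz, hzD⟩ := hx
  obtain ⟨⟨b, rfl⟩, w, hw, hwD⟩ := hy
  rcases lt_trichotomy a b with h | h | h
  · exact absurd (key a b z w h hz hw) hzD
  · rw [h]
  · exact absurd (key b a w z h hw hz) hwD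

/-- The order in which items of equal width are used: lower weight first, ties broken in favour
of the higher index. -/
def Precedes (a b : Item) : Prop :=
  a.weight < b.weight ∨ (a.weight = b.weight ∧ b.index < a.index)

open Classical in
/-- The first `k` items of `S` (all of `S` if it has at most `k` items): those that are preceded
by fewer than `k` items of `S`. -/
def firstItems (k : ℕ) (S : Finset Item) : Finset Item :=
  S.filter fun a => (S.filter fun b => Precedes b a).card < k

/-- The minimum width `ρ*` of the items in `I`. -/
def minWidth (I : Finset Item) (h : I.Nonempty) : ℝ := I.inf' h Item.width

open Classical in
/-- The set `I*` of the items of minimum width. -/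
def smallItems (I : Finset Item) (h : I.Nonempty) : Finset Item :=
  I.filter fun a => a.width = minWidth I h

/-- The package formed from the items in `P`, which are `D` items of the common width `w`. Its
index is lower than that of every item in `I`. -/
def package (D : ℕ) (I : Finset Item) (h : I.Nonempty) (w : ℝ) (P : Finset Item) : Item where
  index := I.inf' h Item.index - 1
  width := D * w
  weight := ∑ a ∈ P, a.weight

theorem firstItems_subset (k : ℕ) (S : Finset Item) : firstItems k S ⊆ S :=
  Finset.filter_subset _ _

theorem smallItems_subset (I : Finset Item) (h : I.Nonempty) : smallItems I h ⊆ I :=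
  Finset.filter_subset _ _

theorem smallItems_nonempty (I : Finset Item) (h : I.Nonempty) : (smallItems I h).Nonempty := by
  obtain ⟨a, ha, hw⟩ := Finset.exists_mem_eq_inf' h Item.width
  exact ⟨a, Finset.mem_filter.2 ⟨ha, hw.symm⟩⟩

theorem le_card_firstItems {k : ℕ} {S : Finset Item} (hk : k ≤ S.card) :
    k ≤ (firstItems k S).card := by
  classical
  by_contra hlt
  have hne : (S \ firstItems k S).Nonempty := by
    rw [Finset.sdiff_nonempty]
    intro hsub
    exact absurd (Finset.card_le_card hsub) (by omega)
  obtain ⟨x, hx, hmin⟩ := Finset.exists_min_image (S \ firstItems k S)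
    (fun a => toLex (a.weight, -a.index)) hne
  rw [Finset.mem_sdiff] at hx
  apply hx.2
  refine Finset.mem_filter.2 ⟨hx.1, lt_of_le_of_lt (Finset.card_le_card ?_) (not_le.1 hlt)⟩
  intro b hb
  obtain ⟨hbS, hbx⟩ := Finset.mem_filter.1 hb
  by_contra hbF
  have := hmin b (Finset.mem_sdiff.2 ⟨hbS, hbF⟩)
  rw [Prod.Lex.toLex_le_toLex] at this
  simp only at this
  rcases hbx with h | ⟨h, h'⟩ <;> rcases this with t | ⟨t, t'⟩
  · exact lt_asymm h t
  · exact absurd t h.ne'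
  · exact absurd h t.ne'
  · omega

open Classical in
/-- The recursive Package-Merge procedure. The result `none` means that none of the cases of the
procedure applies. -/
def packageMerge (D : ℕ) (hD : 2 ≤ D) (I : Finset Item) (total : ℝ) : Option (Finset Item) :=
  if total = 0 then
    -- Basis.
    some ∅
  else if hI : I.Nonempty then
    if IsRemainder D total (minWidth I hI) then
      -- Case 1: the first item is used.
      (packageMerge D hD (I \ firstItems 1 (smallItems I hI)) (total - minWidth I hI)).map
        fun S => S ∪ firstItems 1 (smallItems I hI)
    else if ∃ x, IsRemainder D total x ∧ minWidth I hI < x then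
      if hc : (smallItems I hI).card < D then
        -- Case 2a: the items of minimum width are discarded.
        packageMerge D hD (I \ smallItems I hI) total
      else
        -- Case 2b: the first `D` items of minimum width are packaged.
        let P := firstItems D (smallItems I hI)
        let q := package D I hI (minWidth I hI) P
        (packageMerge D hD (insert q (I \ P)) total).map
          fun S => if q ∈ S then S.erase q ∪ P else S
    else none
  else none
termination_by I.card
decreasing_by
  · have h1 := le_card_firstItems (k := 1) (S := smallItems I hI)
      (Finset.card_pos.2 (smallItems_nonempty I hI))
    refine Finset.card_lt_card (Finset.sdiff_ssubset
      ((firstItems_subset _ _).trans (smallItems_subset I hI)) (Finset.card_pos.1 h1))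
  · exact Finset.card_lt_card (Finset.sdiff_ssubset (smallItems_subset I hI)
      (smallItems_nonempty I hI))
  · have h1 := le_card_firstItems (k := D) (S := smallItems I hI) (not_lt.1 hc)
    have h2 : firstItems D (smallItems I hI) ⊆ I :=
      (firstItems_subset _ _).trans (smallItems_subset I hI)
    have h3 := Finset.card_sdiff_add_card_eq_card h2
    have h4 := Finset.card_insert_le (package D I hI (minWidth I hI)
      (firstItems D (smallItems I hI))) (I \ firstItems D (smallItems I hI))
    omega

/-! ### The bounded-length coding problem -/

/-- The constraints of the bounded-length problem: all lengths lie in `[lmin, lmax]` and the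
Kraft inequality holds. -/
def IsFeasible (D lmin lmax : ℕ) {n : ℕ} (l : Fin n → ℕ) : Prop :=
  (∀ i, lmin ≤ l i ∧ l i ≤ lmax) ∧ ∑ i, ((D : ℝ) ^ l i)⁻¹ ≤ 1

/-- The quasiarithmetic penalty `∑ i, p i * φ (l i - lmin)`. -/
def penalty (φ : ℝ → ℝ) (lmin : ℕ) {n : ℕ} (p : Fin n → ℝ) (l : Fin n → ℕ) : ℝ :=
  ∑ i, p i * φ ((l i : ℝ) - lmin)

/-- `l` solves the bounded-length coding problem. -/
def IsOptimal (D lmin lmax : ℕ) (φ : ℝ → ℝ) {n : ℕ} (p : Fin n → ℝ) (l : Fin n → ℕ) : Prop :=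
  IsFeasible D lmin lmax l ∧
    ∀ l' : Fin n → ℕ, IsFeasible D lmin lmax l' → penalty φ lmin p l ≤ penalty φ lmin p l'

/-- The weights `p` extended by `d` dummy inputs of weight `0`. -/
def withDummies {n : ℕ} (p : Fin n → ℝ) (d : ℕ) : Fin (n + d) → ℝ :=
  Fin.append p fun _ => 0

/-! ### Nodes and nodesets -/

/-- The set of all nodes `(i, l)`, `lmin + 1 ≤ l ≤ lmax`. -/
def nodeGrid (n lmin lmax : ℕ) : Finset (Fin n × ℕ) :=
  Finset.univ ×ˢ Finset.Icc (lmin + 1) lmax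

/-- The nodeset `η(l)` of a length vector `l`: the first `l i - lmin` nodes of each column `i`. -/
def nodeset (lmin : ℕ) {n : ℕ} (l : Fin n → ℕ) : Finset (Fin n × ℕ) :=
  Finset.univ.biUnion fun i => {i} ×ˢ Finset.Icc (lmin + 1) (l i)

/-- The width `D ^ (-l)` of a node `(i, l)`. -/
def nodeWidth (D : ℕ) {n : ℕ} (v : Fin n × ℕ) : ℝ := ((D : ℝ) ^ v.2)⁻¹

/-- The weight `p i * φ (l - lmin) - p i * φ (l - lmin - 1)` of a node `(i, l)`. -/
def nodeWeight (φ : ℝ → ℝ) (lmin : ℕ) {n : ℕ} (p : Fin n → ℝ) (v : Fin n × ℕ) : ℝ :=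
  p v.1 * φ ((v.2 : ℝ) - lmin) - p v.1 * φ ((v.2 : ℝ) - lmin - 1)

/-- The coins of a set `N` of nodes, where the node `v` receives the index `num v`. -/
def nodeItems (D : ℕ) (φ : ℝ → ℝ) (lmin : ℕ) {n : ℕ} (p : Fin n → ℝ) (num : Fin n × ℕ → ℤ)
    (N : Finset (Fin n × ℕ)) : Finset Item :=
  N.image fun v => ⟨num v, nodeWidth D v, nodeWeight φ lmin p v⟩

/-- The total width `(n - D ^ lmin) / (D - 1) * D ^ (-lmin)`. -/
def targetWidth (D lmin n : ℕ) : ℝ :=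
  ((n : ℝ) - (D : ℝ) ^ lmin) / ((D : ℝ) - 1) * ((D : ℝ) ^ lmin)⁻¹

end BoundedCoding

end

namespace BoundedCoding

/-! Two facts about Package-Merge carry the theorem. First, it is optimal whenever some subset has
the required width (`packageMerge_isCoinSolution`). Comparing widths modulo `D` times the minimum
width shows that a solution must use an item of minimum width in case 1, and uses a multiple of `D`
of them in case 2. An exchange argument (`IsCoinSystem.exchange`) lets these be the first ones, at
no cost, so the problem passes to the smaller instance.

Second, the result is the nodeset of a length vector. Optimality alone does not give this: when
weights tie, an optimal set may have gaps in a column. The recursion therefore carries an invariant,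
`IsClosedUnder`. Its last clause compares an item `a` with all replacements of its width that
contain a given item `b` of width `a.width / D`. Quantifying over all replacements makes the clause
survive packaging, and the low index of packages settles the ties. For nodes, convexity makes
weights nondecreasing down a column and monotonicity makes them nonnegative. Hence `(i, k)` is no
heavier than any set of nodes containing `(i, k + 1)`, and columns have no gaps
(`IsClosedUnder.node_mem`).

Coding and coins are linked by sums along columns. The width of a nodeset is the target exactly when
Kraft's inequality is an equality, and its weight is the penalty minus a constant. Kraft equality
costs nothing: modulo `D - 1` the deficit vanishes, so a positive deficit always leaves room to
shorten a longest codeword (`exists_le_kraft_eq_one`). The same congruence makes room for the dummy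
symbols (`IsFeasible.append`). -/

/-! ### The order on items and the first `k` items -/

theorem Precedes.trans {a b c : Item} (h₁ : Precedes a b) (h₂ : Precedes b c) :
    Precedes a c := by
  rcases h₁ with h | ⟨h, h'⟩ <;> rcases h₂ with t | ⟨t, t'⟩
  · exact Or.inl (h.trans t)
  · exact Or.inl (t ▸ h)
  · exact Or.inl (h ▸ t)
  · exact Or.inr ⟨h.trans t, t'.trans h'⟩

theorem Precedes.weight_le {a b : Item} (h : Precedes a b) : a.weight ≤ b.weight := by
  rcases h with h | ⟨h, _⟩
  · exact h.le
  · exact h.le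

theorem precedes_or_precedes {S : Finset Item} (hS : Set.InjOn Item.index (S : Set Item))
    {a b : Item} (ha : a ∈ S) (hb : b ∈ S) (hne : a ≠ b) : Precedes a b ∨ Precedes b a := by
  have hi : a.index ≠ b.index := fun h => hne (hS ha hb h)
  rcases lt_trichotomy a.weight b.weight with h | h | h
  · exact Or.inl (Or.inl h)
  · rcases lt_or_gt_of_ne hi with h' | h'
    · exact Or.inr (Or.inr ⟨h.symm, h'⟩)
    · exact Or.inl (Or.inr ⟨h, h'⟩)
  · exact Or.inr (Or.inl h)

theorem mem_firstItems_of_precedes {k : ℕ} {S : Finset Item} {a b : Item}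
    (ha : a ∈ firstItems k S) (hb : b ∈ S) (h : Precedes b a) : b ∈ firstItems k S := by
  classical
  obtain ⟨_, hk⟩ := Finset.mem_filter.1 ha
  refine Finset.mem_filter.2 ⟨hb, lt_of_le_of_lt (Finset.card_le_card ?_) hk⟩
  exact Finset.monotone_filter_right _ fun c _ hc => Precedes.trans hc h

theorem precedes_of_mem_firstItems {k : ℕ} {S : Finset Item}
    (hS : Set.InjOn Item.index (S : Set Item)) {a b : Item} (ha : a ∈ firstItems k S)
    (hb : b ∈ S) (hb' : b ∉ firstItems k S) : Precedes a b := by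
  have hne : a ≠ b := by rintro rfl; exact hb' ha
  rcases precedes_or_precedes hS (firstItems_subset _ _ ha) hb hne with h | h
  · exact h
  · exact absurd (mem_firstItems_of_precedes ha hb h) hb'

/-- Distinct indices make the order total, so the last of the selected items is preceded by all the
others, and fewer than `k` items precede it. -/
theorem card_firstItems_le {k : ℕ} {S : Finset Item}
    (hS : Set.InjOn Item.index (S : Set Item)) : (firstItems k S).card ≤ k := by
  classical
  rcases (firstItems k S).eq_empty_or_nonempty with h | hne
  · simp [h]
  obtain ⟨x, hx, hmax⟩ := Finset.exists_max_image (firstItems k S)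
    (fun a => toLex (a.weight, -a.index)) hne
  have hk := (Finset.mem_filter.1 hx).2
  have hsub : (firstItems k S).erase x ⊆ S.filter fun b => Precedes b x := by
    intro b hb
    obtain ⟨hbx, hb⟩ := Finset.mem_erase.1 hb
    refine Finset.mem_filter.2 ⟨firstItems_subset _ _ hb, ?_⟩
    rcases precedes_or_precedes hS (firstItems_subset _ _ hb) (firstItems_subset _ _ hx) hbx
      with h | h
    · exact h
    · have := hmax b hb
      rw [Prod.Lex.toLex_le_toLex] at this
      simp only at this
      rcases h with h | ⟨h, h'⟩ <;> rcases this with t | ⟨t, t'⟩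
      · exact absurd h (lt_asymm t)
      · exact absurd t h.ne'
      · exact absurd h t.ne'
      · omega
  have h1 := Finset.card_le_card hsub
  rw [Finset.card_erase_of_mem hx] at h1
  omega

theorem card_firstItems {k : ℕ} {S : Finset Item}
    (hS : Set.InjOn Item.index (S : Set Item)) (hk : k ≤ S.card) :
    (firstItems k S).card = k :=
  le_antisymm (card_firstItems_le hS) (le_card_firstItems hk)

theorem sum_le_sum_of_card_eq {α : Type*} {f : α → ℝ} {X Y : Finset α} (hc : X.card = Y.card)
    (h : ∀ x ∈ X, ∀ y ∈ Y, f x ≤ f y) : ∑ x ∈ X, f x ≤ ∑ y ∈ Y, f y := by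
  rcases X.eq_empty_or_nonempty with rfl | hX
  · obtain rfl : Y = ∅ := Finset.card_eq_zero.1 hc.symm
    simp
  · obtain ⟨m, hm, hmax⟩ := Finset.exists_max_image X f hX
    calc ∑ x ∈ X, f x ≤ X.card • f m := Finset.sum_le_card_nsmul _ _ _ hmax
      _ = Y.card • f m := by rw [hc]
      _ ≤ ∑ y ∈ Y, f y := Finset.card_nsmul_le_sum _ _ _ fun y hy => h m hm y hy

/-- After the common items are cancelled, equally many remain on both sides, and each remaining
first item precedes each remaining item of `T`. -/
theorem totalWeight_firstItems_le {S T : Finset Item}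
    (hS : Set.InjOn Item.index (S : Set Item)) (hT : T ⊆ S) :
    totalWeight (firstItems T.card S) ≤ totalWeight T := by
  have hP := card_firstItems hS (Finset.card_le_card hT)
  unfold totalWeight
  rw [← Finset.sum_inter_add_sum_sdiff (firstItems T.card S) T,
    ← Finset.sum_inter_add_sum_sdiff T (firstItems T.card S), Finset.inter_comm]
  refine add_le_add le_rfl (sum_le_sum_of_card_eq ?_ fun x hx y hy => ?_)
  · have h1 := Finset.card_sdiff_add_card_inter (firstItems T.card S) T
    have h2 := Finset.card_sdiff_add_card_inter T (firstItems T.card S)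
    rw [Finset.inter_comm] at h2
    omega
  · rw [Finset.mem_sdiff] at hx hy
    exact (precedes_of_mem_firstItems hS hx.1 (hT hy.1) hy.2).weight_le

/-! ### Coin systems, width arithmetic and the exchange argument -/

/-- The collections of items on which Package-Merge operates: all widths are powers of `D` and
the items have distinct indices. -/
structure IsCoinSystem (D : ℕ) (I : Finset Item) : Prop where
  width_eq : ∀ a ∈ I, ∃ k : ℤ, a.width = (D : ℝ) ^ k
  injOn : Set.InjOn Item.index (I : Set Item)

theorem IsCoinSystem.mono {D : ℕ} {I J : Finset Item} (hI : IsCoinSystem D I) (h : J ⊆ I) :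
    IsCoinSystem D J :=
  ⟨fun a ha => hI.width_eq a (h ha), hI.injOn.mono (by exact_mod_cast h)⟩

theorem mem_smallItems {I : Finset Item} {h : I.Nonempty} {a : Item} :
    a ∈ smallItems I h ↔ a ∈ I ∧ a.width = minWidth I h := by
  simp [smallItems]

theorem minWidth_le {I : Finset Item} (h : I.Nonempty) {a : Item} (ha : a ∈ I) :
    minWidth I h ≤ a.width :=
  Finset.inf'_le _ ha

theorem IsCoinSystem.minWidth_eq {D : ℕ} {I : Finset Item} (hI : IsCoinSystem D I)
    (h : I.Nonempty) : ∃ k : ℤ, minWidth I h = (D : ℝ) ^ k := by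
  obtain ⟨a, ha⟩ := smallItems_nonempty I h
  rw [mem_smallItems] at ha
  rw [← ha.2]
  exact hI.width_eq a ha.1

theorem IsCoinSystem.width_pos {D : ℕ} (hD : 2 ≤ D) {I : Finset Item} (hI : IsCoinSystem D I)
    {a : Item} (ha : a ∈ I) : 0 < a.width := by
  obtain ⟨k, hk⟩ := hI.width_eq a ha
  rw [hk]; positivity

theorem IsCoinSystem.minWidth_pos {D : ℕ} (hD : 2 ≤ D) {I : Finset Item}
    (hI : IsCoinSystem D I) (h : I.Nonempty) : 0 < minWidth I h := by
  obtain ⟨k, hk⟩ := hI.minWidth_eq h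
  rw [hk]; positivity

theorem exists_eq_mul_pow {D : ℕ} (hD : 2 ≤ D) {x y : ℝ} (hx : ∃ k : ℤ, x = (D : ℝ) ^ k)
    (hy : ∃ k : ℤ, y = (D : ℝ) ^ k) (hxy : x ≤ y) : ∃ k : ℕ, y = x * (D : ℝ) ^ k := by
  obtain ⟨j, rfl⟩ := hx
  obtain ⟨k, rfl⟩ := hy
  have hD1 : (1 : ℝ) < D := by exact_mod_cast hD
  rw [zpow_le_zpow_iff_right₀ hD1] at hxy
  obtain ⟨m, hm⟩ := Int.eq_ofNat_of_zero_le (sub_nonneg.2 hxy)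
  refine ⟨m, ?_⟩
  rw [← zpow_natCast, ← zpow_add₀ (by positivity)]
  congr 1; omega

theorem exists_eq_mul_mul_pow {D : ℕ} (hD : 2 ≤ D) {x y : ℝ} (hx : ∃ k : ℤ, x = (D : ℝ) ^ k)
    (hy : ∃ k : ℤ, y = (D : ℝ) ^ k) (hxy : x < y) :
    ∃ k : ℕ, y = D * x * (D : ℝ) ^ k := by
  obtain ⟨k, hk⟩ := exists_eq_mul_pow hD hx hy hxy.le
  cases k with
  | zero => simp at hk; exact absurd hk hxy.ne'
  | succ k => exact ⟨k, by rw [hk]; ring⟩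

/-- Modulo `D` times the minimum width, only the items of minimum width count. -/
theorem IsCoinSystem.totalWidth_eq {D : ℕ} (hD : 2 ≤ D) {I : Finset Item}
    (hI : IsCoinSystem D I) (h : I.Nonempty) {B : Finset Item} (hB : B ⊆ I) :
    ∃ z : ℕ, totalWidth B =
      minWidth I h * (((B ∩ smallItems I h).card + D * z : ℕ) : ℝ) := by
  induction B using Finset.induction_on with
  | empty => exact ⟨0, by simp [totalWidth]⟩
  | insert a B ha ih =>
    obtain ⟨z, hz⟩ := ih ((Finset.subset_insert _ _).trans hB)
    have haI := hB (Finset.mem_insert_self a B)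
    have hsum : totalWidth (insert a B) = a.width + totalWidth B := Finset.sum_insert ha
    rw [hsum, hz]
    rcases (minWidth_le h haI).eq_or_lt with hw | hw
    · have hmem : a ∈ smallItems I h := mem_smallItems.2 ⟨haI, hw.symm⟩
      refine ⟨z, ?_⟩
      rw [Finset.insert_inter_of_mem hmem,
        Finset.card_insert_of_notMem (fun hh => ha (Finset.mem_inter.1 hh).1), ← hw]
      push_cast; ring
    · have hmem : a ∉ smallItems I h := fun hh => hw.ne' (mem_smallItems.1 hh).2
      obtain ⟨k, hk⟩ := exists_eq_mul_mul_pow hD (hI.minWidth_eq h) (hI.width_eq a haI) hw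
      refine ⟨z + D ^ k, ?_⟩
      rw [Finset.insert_inter_of_notMem hmem, hk]
      push_cast; ring

/-- Writing `m = D ^ e * r` with `r` not divisible by `D`, the remainder is `w * D ^ e`. -/
theorem exists_isRemainder {D : ℕ} (hD : 2 ≤ D) {w total : ℝ} (hw : ∃ k : ℤ, w = (D : ℝ) ^ k)
    {m : ℕ} (hm : total = w * m) (h0 : total ≠ 0) : ∃ x, IsRemainder D total x ∧ w ≤ x := by
  have hm0 : m ≠ 0 := by rintro rfl; simp at hm; exact h0 hm
  obtain ⟨e, r, hr, hmr⟩ := Nat.exists_eq_pow_mul_and_not_dvd hm0 D (by omega)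
  obtain ⟨k, rfl⟩ := hw
  have hD1 : (1 : ℝ) ≤ D := by exact_mod_cast (by omega : 1 ≤ D)
  refine ⟨(D : ℝ) ^ (k + e), ⟨⟨_, rfl⟩, r, ?_, by exact_mod_cast hr⟩, ?_⟩
  · rw [hm, hmr, zpow_add₀ (by positivity), zpow_natCast, div_eq_iff (by positivity)]
    push_cast; ring
  · exact zpow_le_zpow_right₀ hD1 (by omega)

theorem IsRemainder.exists_eq_mul {D : ℕ} (hD : 2 ≤ D) {w total x : ℝ}
    (hw : ∃ k : ℤ, w = (D : ℝ) ^ k) (hx : IsRemainder D total x) (h : w < x) :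
    ∃ z : ℤ, total = z * (D * w) := by
  obtain ⟨k, hk⟩ := exists_eq_mul_mul_pow hD hw hx.1 h
  obtain ⟨⟨j, hj⟩, z, hz, -⟩ := hx
  have hx0 : x ≠ 0 := by rw [hj]; positivity
  rw [div_eq_iff hx0] at hz
  refine ⟨z * D ^ k, ?_⟩
  rw [hz, hk]; push_cast; ring

theorem totalWidth_of_subset_smallItems {I : Finset Item} {h : I.Nonempty} {P : Finset Item}
    (hP : P ⊆ smallItems I h) : totalWidth P = P.card * minWidth I h := by
  unfold totalWidth
  rw [Finset.sum_congr rfl fun a ha => (mem_smallItems.1 (hP ha)).2]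
  simp

theorem totalWidth_union {A B : Finset Item} (h : Disjoint A B) :
    totalWidth (A ∪ B) = totalWidth A + totalWidth B :=
  Finset.sum_union h

theorem totalWeight_union {A B : Finset Item} (h : Disjoint A B) :
    totalWeight (A ∪ B) = totalWeight A + totalWeight B :=
  Finset.sum_union h

theorem totalWidth_sdiff {A B : Finset Item} (h : A ⊆ B) :
    totalWidth (B \ A) = totalWidth B - totalWidth A :=
  Finset.sum_sdiff_eq_sub h

theorem totalWeight_sdiff {A B : Finset Item} (h : A ⊆ B) :
    totalWeight (B \ A) = totalWeight B - totalWeight A :=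
  Finset.sum_sdiff_eq_sub h

/-- A collection with at least `k` items of minimum width can be changed so as to contain the
first `k` of them, at no cost. -/
theorem IsCoinSystem.exchange {D : ℕ} {I : Finset Item} (hI : IsCoinSystem D I)
    (h : I.Nonempty) {B : Finset Item} (hB : B ⊆ I) {k : ℕ}
    (hk : k ≤ (B ∩ smallItems I h).card) :
    ∃ B' ⊆ I, firstItems k (smallItems I h) ⊆ B' ∧ totalWidth B' = totalWidth B ∧
      totalWeight B' ≤ totalWeight B := by
  have hJ : Set.InjOn Item.index (smallItems I h : Set Item) :=
    (hI.mono (smallItems_subset I h)).injOn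
  have hPc : (firstItems k (smallItems I h)).card = k :=
    card_firstItems hJ (hk.trans (Finset.card_le_card Finset.inter_subset_right))
  have hPJ := firstItems_subset k (smallItems I h)
  -- `T` consists of the `k` items to be traded for the first `k`. It includes those first items
  -- that `B` already has, so that the new union is disjoint.
  obtain ⟨T, hT1, hT2, hTc⟩ := Finset.exists_subsuperset_card_eq
    (s := B ∩ firstItems k (smallItems I h)) (t := B ∩ smallItems I h)
    (Finset.inter_subset_inter_left hPJ)
    ((Finset.card_le_card Finset.inter_subset_right).trans hPc.le) hk
  have hTB : T ⊆ B := hT2.trans Finset.inter_subset_left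
  have hTJ : T ⊆ smallItems I h := hT2.trans Finset.inter_subset_right
  have hdis : Disjoint (B \ T) (firstItems k (smallItems I h)) := by
    rw [Finset.disjoint_left]
    intro a ha haP
    rw [Finset.mem_sdiff] at ha
    exact ha.2 (hT1 (Finset.mem_inter.2 ⟨ha.1, haP⟩))
  refine ⟨B \ T ∪ firstItems k (smallItems I h), ?_, Finset.subset_union_right, ?_, ?_⟩
  · exact Finset.union_subset (Finset.sdiff_subset.trans hB)
      (hPJ.trans (smallItems_subset I h))
  · rw [totalWidth_union hdis, totalWidth_sdiff hTB, totalWidth_of_subset_smallItems hTJ,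
      totalWidth_of_subset_smallItems hPJ, hPc, hTc]
    ring
  · have := totalWeight_firstItems_le hJ hTJ
    rw [hTc] at this
    rw [totalWeight_union hdis, totalWeight_sdiff hTB]
    linarith

theorem package_index_lt (D : ℕ) {I : Finset Item} (h : I.Nonempty) (w : ℝ) (P : Finset Item)
    {a : Item} (ha : a ∈ I) : (package D I h w P).index < a.index := by
  have : I.inf' h Item.index ≤ a.index := Finset.inf'_le _ ha
  simp only [package]; omega

theorem package_notMem (D : ℕ) {I : Finset Item} (h : I.Nonempty) (w : ℝ) (P : Finset Item) :
    package D I h w P ∉ I :=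
  fun hq => lt_irrefl _ (package_index_lt D h w P hq)

theorem IsCoinSystem.insert_package {D : ℕ} (hD : 2 ≤ D) {I : Finset Item}
    (hI : IsCoinSystem D I) (h : I.Nonempty) (P : Finset Item) :
    IsCoinSystem D (insert (package D I h (minWidth I h) P) (I \ P)) := by
  have hsub := hI.mono (J := I \ P) Finset.sdiff_subset
  constructor
  · intro a ha
    rcases Finset.mem_insert.1 ha with rfl | ha
    · obtain ⟨k, hk⟩ := hI.minWidth_eq h
      refine ⟨k + 1, ?_⟩
      simp only [package]
      rw [hk, zpow_add_one₀ (by positivity), mul_comm]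
    · exact hsub.width_eq a ha
  · rw [Finset.coe_insert, Set.injOn_insert]
    · refine ⟨hsub.injOn, ?_⟩
      rintro ⟨a, ha, hq⟩
      exact (package_index_lt D h _ P (Finset.sdiff_subset (by exact_mod_cast ha))).ne' hq
    · intro hq
      exact package_notMem D h _ P (Finset.sdiff_subset (by exact_mod_cast hq))

/-! ### Unpacking, and the equations of the recursion -/

/-- Replaces the item `q` by the items in `P`. -/
noncomputable def unpack (q : Item) (P S : Finset Item) : Finset Item :=
  if q ∈ S then S.erase q ∪ P else S

theorem unpack_subset {q : Item} {P S I : Finset Item} (hP : P ⊆ I)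
    (hS : S ⊆ insert q (I \ P)) : unpack q P S ⊆ I := by
  unfold unpack
  split_ifs with hq
  · refine Finset.union_subset (fun a ha => ?_) hP
    obtain ⟨hne, ha⟩ := Finset.mem_erase.1 ha
    exact Finset.sdiff_subset ((Finset.mem_insert.1 (hS ha)).resolve_left hne)
  · intro a ha
    rcases Finset.mem_insert.1 (hS ha) with rfl | h
    · exact absurd ha hq
    · exact Finset.sdiff_subset h

/-- Serves both widths and weights: a package has the total width and the total weight of its
contents. -/
theorem sum_unpack {f : Item → ℝ} {q : Item} {P S I : Finset Item}
    (hS : S ⊆ insert q (I \ P)) (hf : f q = ∑ a ∈ P, f a) :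
    ∑ a ∈ unpack q P S, f a = ∑ a ∈ S, f a := by
  unfold unpack
  split_ifs with hq
  · have hdis : Disjoint (S.erase q) P := by
      rw [Finset.disjoint_left]
      intro a ha haP
      obtain ⟨hne, ha⟩ := Finset.mem_erase.1 ha
      exact (Finset.mem_sdiff.1 ((Finset.mem_insert.1 (hS ha)).resolve_left hne)).2 haP
    rw [Finset.sum_union hdis, ← hf, Finset.sum_erase_add _ _ hq]
  · rfl

section Equations

variable {D : ℕ} {hD : 2 ≤ D} {I : Finset Item} {total : ℝ}

theorem packageMerge_zero : packageMerge D hD I 0 = some ∅ := by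
  rw [packageMerge, if_pos rfl]

theorem packageMerge_of_isRemainder (h0 : total ≠ 0) (hI : I.Nonempty)
    (hr : IsRemainder D total (minWidth I hI)) :
    packageMerge D hD I total =
      (packageMerge D hD (I \ firstItems 1 (smallItems I hI)) (total - minWidth I hI)).map
        fun S => S ∪ firstItems 1 (smallItems I hI) := by
  rw [packageMerge, if_neg h0, dif_pos hI, if_pos hr]

theorem packageMerge_of_card_lt (h0 : total ≠ 0) (hI : I.Nonempty)
    (hr : ¬ IsRemainder D total (minWidth I hI))
    (hx : ∃ x, IsRemainder D total x ∧ minWidth I hI < x) (hc : (smallItems I hI).card < D) :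
    packageMerge D hD I total = packageMerge D hD (I \ smallItems I hI) total := by
  rw [packageMerge, if_neg h0, dif_pos hI, if_neg hr, if_pos hx, dif_pos hc]

theorem packageMerge_of_le_card (h0 : total ≠ 0) (hI : I.Nonempty)
    (hr : ¬ IsRemainder D total (minWidth I hI))
    (hx : ∃ x, IsRemainder D total x ∧ minWidth I hI < x) (hc : ¬ (smallItems I hI).card < D) :
    packageMerge D hD I total =
      (packageMerge D hD
        (insert (package D I hI (minWidth I hI) (firstItems D (smallItems I hI)))
          (I \ firstItems D (smallItems I hI))) total).map
        (unpack (package D I hI (minWidth I hI) (firstItems D (smallItems I hI)))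
          (firstItems D (smallItems I hI))) := by
  rw [packageMerge, if_neg h0, dif_pos hI, if_neg hr, if_pos hx, dif_neg hc]
  rfl

theorem packageMerge_eq_none (h0 : total ≠ 0)
    (h : ∀ hI : I.Nonempty, ¬ IsRemainder D total (minWidth I hI) ∧
      ¬ ∃ x, IsRemainder D total x ∧ minWidth I hI < x) :
    packageMerge D hD I total = none := by
  rw [packageMerge, if_neg h0]
  split_ifs with hI h1 h2 h3
  · exact absurd h1 (h hI).1
  · exact absurd h2 (h hI).2
  · exact absurd h2 (h hI).2
  · rfl
  · rfl

end Equations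

theorem firstItems_subset_self (k : ℕ) {I : Finset Item} (hI : I.Nonempty) :
    firstItems k (smallItems I hI) ⊆ I :=
  (firstItems_subset _ _).trans (smallItems_subset I hI)

theorem card_sdiff_lt {I P : Finset Item} (hP : P ⊆ I) (hne : P.Nonempty) :
    (I \ P).card < I.card :=
  Finset.card_lt_card (Finset.sdiff_ssubset hP hne)

theorem card_insert_sdiff_lt {I P : Finset Item} (q : Item) (hP : P ⊆ I) (hc : 2 ≤ P.card) :
    (insert q (I \ P)).card < I.card := by
  have h1 := Finset.card_sdiff_add_card_eq_card hP
  have h2 := Finset.card_insert_le q (I \ P)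
  omega

theorem IsCoinSystem.injOn_smallItems {D : ℕ} {I : Finset Item} (hI : IsCoinSystem D I)
    (h : I.Nonempty) : Set.InjOn Item.index (smallItems I h : Set Item) :=
  (hI.mono (smallItems_subset I h)).injOn

theorem package_width (D : ℕ) {I : Finset Item} (h : I.Nonempty) (P : Finset Item) :
    (package D I h (minWidth I h) P).width = D * minWidth I h := rfl

theorem package_weight (D : ℕ) {I : Finset Item} (h : I.Nonempty) (w : ℝ) (P : Finset Item) :
    (package D I h w P).weight = totalWeight P := rfl

/-! ### Optimality of Package-Merge -/

/-- Package-Merge solves every solvable Coin Collector's problem. -/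
theorem packageMerge_isCoinSolution {D : ℕ} (hD : 2 ≤ D) {I : Finset Item} {total : ℝ}
    (hI : IsCoinSystem D I) (hex : ∃ B ⊆ I, totalWidth B = total) :
    ∃ S, packageMerge D hD I total = some S ∧ IsCoinSolution I total S := by
  induction hn : I.card using Nat.strong_induction_on generalizing I total with
  | _ n ih =>
  subst hn
  by_cases h0 : total = 0
  · subst h0
    refine ⟨∅, packageMerge_zero, Finset.empty_subset _, by simp [totalWidth], ?_⟩
    intro B hB hB0
    obtain rfl : B = ∅ := by
      by_contra hne
      have := Finset.sum_pos (fun a ha => hI.width_pos hD (hB ha))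
        (Finset.nonempty_iff_ne_empty.2 hne)
      exact this.ne' hB0
    exact le_rfl
  have hne : I.Nonempty := by
    obtain ⟨B, hB, hBt⟩ := hex
    rw [Finset.nonempty_iff_ne_empty]
    rintro rfl
    rw [Finset.subset_empty.1 hB] at hBt
    exact h0 (by rw [← hBt]; simp [totalWidth])
  have hw := hI.minWidth_eq hne
  have hwpos := hI.minWidth_pos hD hne
  have hJinj := hI.injOn_smallItems hne
  by_cases hr : IsRemainder D total (minWidth I hne)
  · rw [packageMerge_of_isRemainder h0 hne hr]
    have hPI : firstItems 1 (smallItems I hne) ⊆ I := firstItems_subset_self 1 hne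
    have hPc : (firstItems 1 (smallItems I hne)).card = 1 :=
      card_firstItems hJinj (Finset.card_pos.2 (smallItems_nonempty I hne))
    have hPw := totalWidth_of_subset_smallItems (firstItems_subset 1 (smallItems I hne))
    rw [hPc, Nat.cast_one, one_mul] at hPw
    -- A solution without items of minimum width would make `total / minWidth I hne` a multiple of
    -- `D`, against the choice of the remainder.
    have hexch : ∀ B ⊆ I, totalWidth B = total → ∃ B' ⊆ I,
        firstItems 1 (smallItems I hne) ⊆ B' ∧ totalWidth B' = totalWidth B ∧
        totalWeight B' ≤ totalWeight B := by
      intro B hB hBt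
      refine hI.exchange hne hB (Nat.one_le_iff_ne_zero.2 fun hc => ?_)
      obtain ⟨z, hz⟩ := hI.totalWidth_eq hD hne hB
      obtain ⟨_, m, hm, hDm⟩ := hr
      rw [hc, zero_add] at hz
      rw [← hBt, hz, mul_div_cancel_left₀ _ hwpos.ne'] at hm
      exact hDm ⟨z, by exact_mod_cast hm.symm⟩
    generalize firstItems 1 (smallItems I hne) = P at *
    obtain ⟨S, hS, hSI, hSw, hSopt⟩ := ih (I \ P).card
      (card_sdiff_lt hPI (Finset.card_pos.1 (by omega))) (total := total - minWidth I hne)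
      (hI.mono Finset.sdiff_subset) (by
        obtain ⟨B, hB, hBt⟩ := hex
        obtain ⟨B', hB', hPB, hw', -⟩ := hexch B hB hBt
        exact ⟨B' \ P, Finset.sdiff_subset_sdiff hB' le_rfl, by
          rw [totalWidth_sdiff hPB, hw', hBt, hPw]⟩) rfl
    have hdis : Disjoint S P := Finset.disjoint_of_subset_left hSI Finset.sdiff_disjoint
    refine ⟨S ∪ P, by rw [hS]; rfl,
      Finset.union_subset (hSI.trans Finset.sdiff_subset) hPI, ?_, ?_⟩
    · rw [totalWidth_union hdis, hSw, hPw]; ring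
    · intro B hB hBt
      obtain ⟨B', hB', hPB, hw', hle⟩ := hexch B hB hBt
      have := hSopt (B' \ P) (Finset.sdiff_subset_sdiff hB' le_rfl)
        (by rw [totalWidth_sdiff hPB, hw', hBt, hPw])
      rw [totalWeight_sdiff hPB] at this
      rw [totalWeight_union hdis]
      linarith
  -- Solvability makes `total` an integer multiple of the minimum width, so the remainder cannot be
  -- smaller than it and the recursion never gets stuck.
  have hx : ∃ x, IsRemainder D total x ∧ minWidth I hne < x := by
    obtain ⟨B, hB, hBt⟩ := hex
    obtain ⟨z, hz⟩ := hI.totalWidth_eq hD hne hB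
    obtain ⟨x, hx, hwx⟩ := exists_isRemainder hD hw (hBt.symm.trans hz) h0
    refine ⟨x, hx, lt_of_le_of_ne hwx ?_⟩
    rintro rfl
    exact hr hx
  -- Here `total` is a multiple of `D` times the minimum width, and so is the part of it covered by
  -- wider items. A solution thus uses either none or at least `D` of the items of minimum width.
  have hdvd : ∀ B ⊆ I, totalWidth B = total → D ∣ (B ∩ smallItems I hne).card := by
    intro B hB hBt
    obtain ⟨z, hz⟩ := hI.totalWidth_eq hD hne hB
    obtain ⟨x, hx, hwx⟩ := hx
    obtain ⟨m, hm⟩ := hx.exists_eq_mul hD hw hwx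
    rw [hBt, hm, ← mul_assoc, mul_comm] at hz
    have hz := mul_left_cancel₀ hwpos.ne' hz
    have hz' : m * D = ((B ∩ smallItems I hne).card : ℤ) + D * z := by exact_mod_cast hz
    have : (D : ℤ) ∣ ((B ∩ smallItems I hne).card : ℤ) := ⟨m - z, by linarith⟩
    exact_mod_cast this
  have havoid : ∀ B ⊆ I, B ∩ smallItems I hne = ∅ → B ⊆ I \ smallItems I hne := by
    intro B hB h a ha
    refine Finset.mem_sdiff.2 ⟨hB ha, fun h' => ?_⟩
    have : a ∈ B ∩ smallItems I hne := Finset.mem_inter.2 ⟨ha, h'⟩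
    simp [h] at this
  by_cases hc : (smallItems I hne).card < D
  · rw [packageMerge_of_card_lt h0 hne hr hx hc]
    have hsub : ∀ B ⊆ I, totalWidth B = total → B ⊆ I \ smallItems I hne := by
      intro B hB hBt
      refine havoid B hB (Finset.card_eq_zero.1 ?_)
      exact Nat.eq_zero_of_dvd_of_lt (hdvd B hB hBt)
        ((Finset.card_le_card Finset.inter_subset_right).trans_lt hc)
    obtain ⟨S, hS, hSI, hSw, hSopt⟩ := ih _
      (card_sdiff_lt (smallItems_subset I hne) (smallItems_nonempty I hne)) (total := total)
      (hI.mono Finset.sdiff_subset) (by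
        obtain ⟨B, hB, hBt⟩ := hex
        exact ⟨B, hsub B hB hBt, hBt⟩) rfl
    exact ⟨S, hS, hSI.trans Finset.sdiff_subset, hSw,
      fun B hB hBt => hSopt B (hsub B hB hBt) hBt⟩
  · rw [packageMerge_of_le_card h0 hne hr hx hc]
    have hPI : firstItems D (smallItems I hne) ⊆ I := firstItems_subset_self D hne
    have hPJ := firstItems_subset D (smallItems I hne)
    have hPc : (firstItems D (smallItems I hne)).card = D :=
      card_firstItems hJinj (not_lt.1 hc)
    have hPw := totalWidth_of_subset_smallItems hPJ
    rw [hPc] at hPw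
    -- Either `B` avoids the items of minimum width and survives packaging, or an exchange makes it
    -- contain the whole package.
    have hpack : ∀ B ⊆ I, totalWidth B = total →
        ∃ B' ⊆ insert (package D I hne (minWidth I hne) (firstItems D (smallItems I hne)))
          (I \ firstItems D (smallItems I hne)), totalWidth B' = total ∧
          totalWeight B' ≤ totalWeight B := by
      intro B hB hBt
      rcases Nat.eq_zero_or_pos (B ∩ smallItems I hne).card with hz | hpos
      · refine ⟨B, fun a ha => Finset.mem_insert_of_mem ?_, hBt, le_rfl⟩
        exact Finset.sdiff_subset_sdiff le_rfl hPJ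
          (havoid B hB (Finset.card_eq_zero.1 hz) ha)
      · obtain ⟨B', hB', hPB, hw', hle⟩ :=
          hI.exchange hne hB (Nat.le_of_dvd hpos (hdvd B hB hBt))
        have hq : package D I hne (minWidth I hne) (firstItems D (smallItems I hne)) ∉
            B' \ firstItems D (smallItems I hne) := fun h =>
          package_notMem D hne _ _ (hB' (Finset.sdiff_subset h))
        refine ⟨insert _ (B' \ firstItems D (smallItems I hne)),
          Finset.insert_subset_insert _ (Finset.sdiff_subset_sdiff hB' le_rfl), ?_, ?_⟩
        · rw [totalWidth, Finset.sum_insert hq, package_width, ← hPw]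
          have := totalWidth_sdiff hPB
          rw [totalWidth] at this
          rw [this, hw', hBt]; ring
        · rw [totalWeight, Finset.sum_insert hq, package_weight]
          have := totalWeight_sdiff hPB
          rw [totalWeight] at this
          rw [this]; linarith
    have hsys := hI.insert_package hD hne (firstItems D (smallItems I hne))
    have hqw := package_width D hne (firstItems D (smallItems I hne))
    rw [← hPw] at hqw
    have hqw' := package_weight D hne (minWidth I hne) (firstItems D (smallItems I hne))
    generalize firstItems D (smallItems I hne) = P at *
    generalize package D I hne (minWidth I hne) P = q at *
    obtain ⟨S, hS, hSI, hSw, hSopt⟩ := ih _ (card_insert_sdiff_lt q hPI (by omega))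
      (total := total) hsys (by
        obtain ⟨B, hB, hBt⟩ := hex
        obtain ⟨B', hB', hw', -⟩ := hpack B hB hBt
        exact ⟨B', hB', hw'⟩) rfl
    refine ⟨unpack q P S, by rw [hS]; rfl, unpack_subset hPI hSI, ?_, ?_⟩
    · rw [← hSw]
      exact sum_unpack hSI hqw
    · intro B hB hBt
      obtain ⟨B', hB', hw', hle⟩ := hpack B hB hBt
      have h1 : totalWeight (unpack q P S) = totalWeight S := sum_unpack hSI hqw'
      rw [h1]
      exact (hSopt B' hB' hw').trans hle

/-! ### Closure of the result under lighter items -/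

/-- The closure properties of the result `S` of Package-Merge: it contains with every item the
items that precede it, and with every item `b` the items `a` that are `D` times as wide and no
heavier than any replacement for `a` that makes use of `b`. -/
structure IsClosedUnder (D : ℕ) (I : Finset Item) (total : ℝ) (S : Finset Item) : Prop where
  subset : S ⊆ I
  of_precedes : ∀ a ∈ I, ∀ b ∈ S, a.width = b.width → Precedes a b → a ∈ S
  of_weight_le : ∀ a ∈ I, ∀ b ∈ S, a.width = D * b.width → (∃ z : ℤ, total = z * a.width) →
    (∀ T ⊆ I, b ∈ T → totalWidth T = a.width → a.weight ≤ totalWeight T) → a ∈ S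

/-- A replacement for a package that makes use of an item of minimum width consists of `D` items
of minimum width. -/
theorem IsCoinSystem.package_weight_le {D : ℕ} (hD : 2 ≤ D) {I : Finset Item}
    (hI : IsCoinSystem D I) (h : I.Nonempty) {T : Finset Item}
    (hT : T ⊆ insert (package D I h (minWidth I h) (firstItems D (smallItems I h)))
      (I \ firstItems D (smallItems I h))) {b : Item} (hb : b ∈ T)
    (hbw : b.width = minWidth I h) (hTw : totalWidth T = D * minWidth I h) :
    totalWeight (firstItems D (smallItems I h)) ≤ totalWeight T := by
  have hw := hI.minWidth_eq h
  have hwpos := hI.minWidth_pos hD h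
  have hsys := hI.insert_package hD h (firstItems D (smallItems I h))
  have hDR : (2 : ℝ) ≤ D := by exact_mod_cast hD
  have hmin : ∀ x ∈ T, x.width = minWidth I h := by
    intro x hx
    have hle : minWidth I h ≤ x.width := by
      rcases Finset.mem_insert.1 (hT hx) with rfl | hxI
      · rw [package_width]; nlinarith
      · exact minWidth_le h (Finset.sdiff_subset hxI)
    refine (hle.eq_or_lt.resolve_right fun hlt => ?_).symm
    -- An item wider than the minimum already has width at least `D * minWidth I h`; together with
    -- `b` it would exceed the width of `T`.
    obtain ⟨k, hk⟩ := exists_eq_mul_mul_pow hD hw (hsys.width_eq x (hT hx)) hlt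
    have hk1 : (1 : ℝ) ≤ (D : ℝ) ^ k := one_le_pow₀ (by linarith)
    have hxb : x ≠ b := by rintro rfl; exact hlt.ne' hbw
    have hsum : ∑ y ∈ {x, b}, y.width ≤ totalWidth T :=
      Finset.sum_le_sum_of_subset_of_nonneg (by
          intro y hy
          rcases Finset.mem_insert.1 hy with rfl | hy
          · exact hx
          · rw [Finset.mem_singleton.1 hy]; exact hb)
        fun y hy _ => (hsys.width_pos hD (hT hy)).le
    rw [Finset.sum_pair hxb, hTw, hbw, hk] at hsum
    have : 0 < D * minWidth I h := by positivity
    nlinarith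
  have hTJ : T ⊆ smallItems I h := by
    intro x hx
    refine mem_smallItems.2 ⟨?_, hmin x hx⟩
    rcases Finset.mem_insert.1 (hT hx) with rfl | hxI
    · have := hmin _ hx
      rw [package_width] at this
      nlinarith
    · exact Finset.sdiff_subset hxI
  rw [totalWidth_of_subset_smallItems hTJ] at hTw
  have hcard : T.card = D := by exact_mod_cast mul_right_cancel₀ hwpos.ne' hTw
  have := totalWeight_firstItems_le (hI.injOn_smallItems h) hTJ
  rwa [hcard] at this

/-- The invariant is pulled back through each recursive call. The delicate case is 2b, where the two
closure clauses feed each other: the weight clause brings in the package, and the order clause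
compares an item with it. -/
theorem packageMerge_isClosedUnder {D : ℕ} (hD : 2 ≤ D) {I : Finset Item} {total : ℝ}
    (hI : IsCoinSystem D I) {S : Finset Item} (hS : packageMerge D hD I total = some S) :
    IsClosedUnder D I total S := by
  induction hn : I.card using Nat.strong_induction_on generalizing I total S with
  | _ n ih =>
  subst hn
  by_cases h0 : total = 0
  · subst h0
    rw [packageMerge_zero] at hS
    obtain rfl := Option.some.inj hS
    exact ⟨Finset.empty_subset _, by simp, by simp⟩
  by_cases hne : I.Nonempty
  swap
  · rw [packageMerge_eq_none h0 fun h => absurd h hne] at hS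
    simp at hS
  have hw := hI.minWidth_eq hne
  have hwpos := hI.minWidth_pos hD hne
  have hJinj := hI.injOn_smallItems hne
  have hDR : (2 : ℝ) ≤ D := by exact_mod_cast hD
  by_cases hr : IsRemainder D total (minWidth I hne)
  · rw [packageMerge_of_isRemainder h0 hne hr] at hS
    obtain ⟨S', hS', rfl⟩ := Option.map_eq_some_iff.1 hS
    have hPI : firstItems 1 (smallItems I hne) ⊆ I := firstItems_subset_self 1 hne
    have hPc : (firstItems 1 (smallItems I hne)).card = 1 :=
      card_firstItems hJinj (Finset.card_pos.2 (smallItems_nonempty I hne))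
    have IH := ih _ (card_sdiff_lt hPI (Finset.card_pos.1 (by omega)))
      (hI.mono Finset.sdiff_subset) hS' rfl
    have hsub : S' ∪ firstItems 1 (smallItems I hne) ⊆ I :=
      Finset.union_subset (IH.subset.trans Finset.sdiff_subset) hPI
    refine ⟨hsub, ?_, ?_⟩
    · intro a ha b hb hab hp
      by_cases haP : a ∈ firstItems 1 (smallItems I hne)
      · exact Finset.mem_union_right _ haP
      rcases Finset.mem_union.1 hb with hb | hb
      · exact Finset.mem_union_left _
          (IH.of_precedes a (Finset.mem_sdiff.2 ⟨ha, haP⟩) b hb hab hp)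
      · refine Finset.mem_union_right _ (mem_firstItems_of_precedes hb ?_ hp)
        exact mem_smallItems.2
          ⟨ha, hab.trans (mem_smallItems.1 (firstItems_subset _ _ hb)).2⟩
    -- The weight clause is vacuous in this case: `a` is at least `D` times as wide as the minimum,
    -- so `total` cannot be a multiple of its width.
    · rintro a ha b hb hab ⟨z, hz⟩ -
      exfalso
      obtain ⟨_, m, hm, hDm⟩ := hr
      obtain ⟨k, hk⟩ := exists_eq_mul_pow hD hw (hI.width_eq b (hsub hb))
        (minWidth_le hne (hsub hb))
      rw [hz, hab, hk, div_eq_iff hwpos.ne'] at hm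
      have hm' : (z : ℝ) * D * D ^ k = m := by
        apply mul_right_cancel₀ hwpos.ne'
        rw [← hm]; ring
      refine hDm ⟨z * D ^ k, ?_⟩
      have : z * D * D ^ k = m := by exact_mod_cast hm'
      rw [← this]; ring
  by_cases hx : ∃ x, IsRemainder D total x ∧ minWidth I hne < x
  swap
  · rw [packageMerge_eq_none h0 fun h => ⟨hr, hx⟩] at hS
    simp at hS
  by_cases hc : (smallItems I hne).card < D
  · rw [packageMerge_of_card_lt h0 hne hr hx hc] at hS
    have IH := ih _ (card_sdiff_lt (smallItems_subset I hne) (smallItems_nonempty I hne))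
      (hI.mono Finset.sdiff_subset) hS rfl
    have hkeep : ∀ a ∈ I, ∀ b ∈ S, b.width ≤ a.width → a ∈ I \ smallItems I hne := by
      intro a ha b hb hab
      refine Finset.mem_sdiff.2 ⟨ha, fun haJ => ?_⟩
      have hb' := Finset.mem_sdiff.1 (IH.subset hb)
      rw [(mem_smallItems.1 haJ).2] at hab
      exact hb'.2 (mem_smallItems.2 ⟨hb'.1, le_antisymm hab (minWidth_le hne hb'.1)⟩)
    refine ⟨IH.subset.trans Finset.sdiff_subset, ?_, ?_⟩
    · intro a ha b hb hab hp
      exact IH.of_precedes a (hkeep a ha b hb hab.ge) b hb hab hp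
    · intro a ha b hb hab hz hT
      refine IH.of_weight_le a (hkeep a ha b hb ?_) b hb hab hz
        fun T hTI => hT T (hTI.trans Finset.sdiff_subset)
      have := hI.width_pos hD (Finset.sdiff_subset (IH.subset hb))
      rw [hab]; nlinarith
  · rw [packageMerge_of_le_card h0 hne hr hx hc] at hS
    obtain ⟨S', hS', rfl⟩ := Option.map_eq_some_iff.1 hS
    have hPI : firstItems D (smallItems I hne) ⊆ I := firstItems_subset_self D hne
    have hPJ := firstItems_subset D (smallItems I hne)
    have hPc : (firstItems D (smallItems I hne)).card = D :=
      card_firstItems hJinj (not_lt.1 hc)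
    have hPw := totalWidth_of_subset_smallItems hPJ
    rw [hPc] at hPw
    have hfirst : ∀ a ∈ I, ∀ b ∈ firstItems D (smallItems I hne), a.width = b.width →
        Precedes a b → a ∈ firstItems D (smallItems I hne) := by
      intro a ha b hb hab hp
      exact mem_firstItems_of_precedes hb
        (mem_smallItems.2 ⟨ha, hab.trans (mem_smallItems.1 (hPJ hb)).2⟩) hp
    have hPwid : ∀ a ∈ firstItems D (smallItems I hne), a.width = minWidth I hne :=
      fun a ha => (mem_smallItems.1 (hPJ ha)).2
    have hsys := hI.insert_package hD hne (firstItems D (smallItems I hne))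
    have IH := ih _ (card_insert_sdiff_lt _ hPI (by omega)) hsys hS' rfl
    have hqI := package_notMem D hne (minWidth I hne) (firstItems D (smallItems I hne))
    have hqind := fun a => package_index_lt D hne (minWidth I hne)
      (firstItems D (smallItems I hne)) (a := a)
    have hqw := package_width D hne (firstItems D (smallItems I hne))
    have hqw' := package_weight D hne (minWidth I hne) (firstItems D (smallItems I hne))
    have hqle : ∀ T ⊆ insert (package D I hne (minWidth I hne)
        (firstItems D (smallItems I hne))) (I \ firstItems D (smallItems I hne)),
        ∀ b ∈ T, b.width = minWidth I hne → totalWidth T = D * minWidth I hne →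
        totalWeight (firstItems D (smallItems I hne)) ≤ totalWeight T :=
      fun T hT b hb => hI.package_weight_le hD hne hT hb
    generalize firstItems D (smallItems I hne) = P at *
    generalize package D I hne (minWidth I hne) P = q at *
    have hPuse : q ∈ S' → P ⊆ unpack q P S' := by
      intro hq
      rw [unpack, if_pos hq]
      exact Finset.subset_union_right
    have hmono : ∀ a ∈ S', a ≠ q → a ∈ unpack q P S' := by
      intro a ha haq
      unfold unpack
      split_ifs
      · exact Finset.mem_union_left _ (Finset.mem_erase.2 ⟨haq, ha⟩)
      · exact ha
    have hcases : ∀ b ∈ unpack q P S', (q ∈ S' ∧ b ∈ P) ∨ (b ∈ S' ∧ b ≠ q) := by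
      intro b hb
      unfold unpack at hb
      split_ifs at hb with hq
      · rcases Finset.mem_union.1 hb with hb | hb
        · exact Or.inr (Finset.mem_erase.1 hb).symm
        · exact Or.inl ⟨hq, hb⟩
      · refine Or.inr ⟨hb, ?_⟩
        rintro rfl
        exact hq hb
    have hneq : ∀ a ∈ I, a ≠ q := by
      rintro a ha rfl
      exact hqI ha
    have hin : ∀ a ∈ I, a ∉ P → a ∈ insert q (I \ P) := fun a ha haP =>
      Finset.mem_insert_of_mem (Finset.mem_sdiff.2 ⟨ha, haP⟩)
    have hout : ∀ b ∈ S', b ≠ q → b ∈ I ∧ b ∉ P := fun b hb hbq =>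
      Finset.mem_sdiff.1 ((Finset.mem_insert.1 (IH.subset hb)).resolve_left hbq)
    refine ⟨unpack_subset hPI IH.subset, ?_, ?_⟩
    · intro a ha b hb hab hp
      rcases hcases b hb with ⟨hq, hbP⟩ | ⟨hbS, hbq⟩
      · exact hPuse hq (hfirst a ha b hbP hab hp)
      by_cases haP : a ∈ P
      -- `b` is chosen outside `P` while the earlier `a` lies in `P`. The weight clause applied to
      -- the package itself gives `q ∈ S'`, since `P` is the cheapest set of `D` items of minimum
      -- width; hence all of `P` is used.
      · refine hPuse ?_ haP
        have hbw : b.width = minWidth I hne := by rw [← hab, hPwid a haP]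
        obtain ⟨x, hx, hwx⟩ := hx
        refine IH.of_weight_le q (Finset.mem_insert_self _ _) b hbS (by rw [hqw, hbw])
          (by rw [hqw]; exact hx.exists_eq_mul hD hw hwx) fun T hT hbT hTw => ?_
        rw [hqw']
        exact hqle T hT b hbT hbw (by rw [hTw, hqw])
      · exact hmono a (IH.of_precedes a (hin a ha haP) b hbS hab hp) (hneq a ha)
    · intro a ha b hb hab hz hT
      have hbI : b ∈ I := unpack_subset hPI IH.subset hb
      have hbpos := hI.width_pos hD hbI
      have haP : a ∉ P := by
        intro haP
        have h1 := hPwid a haP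
        have h2 := minWidth_le hne hbI
        rw [hab] at h1
        nlinarith
      refine hmono a ?_ (hneq a ha)
      rcases hcases b hb with ⟨hq, hbP⟩ | ⟨hbS, hbq⟩
      · have haw : a.width = D * minWidth I hne := by rw [hab, hPwid b hbP]
        refine IH.of_precedes a (hin a ha haP) q hq (by rw [haw, hqw]) ?_
        -- `P` is itself a replacement for `a` containing `b`, so `a` weighs no more than the
        -- package. If the weights tie, `a` still precedes it, because packages have the lowest
        -- index.
        have hle := hT P hPI hbP (by rw [hPw, haw])
        rw [← hqw'] at hle
        rcases hle.lt_or_eq with h | h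
        · exact Or.inl h
        · exact Or.inr ⟨h, hqind a ha⟩
      -- Unpacking turns a replacement in the new instance into one in the old instance with the
      -- same width and weight, still containing `b`.
      · refine IH.of_weight_le a (hin a ha haP) b hbS hab hz fun T hTI hbT hTw => ?_
        have h1 : totalWeight (unpack q P T) = totalWeight T := sum_unpack hTI hqw'
        have h2 : totalWidth (unpack q P T) = totalWidth T :=
          sum_unpack hTI (by rw [hqw, ← hPw]; rfl)
        rw [← h1]
        refine hT _ (unpack_subset hPI hTI) ?_ (by rw [h2, hTw])
        unfold unpack
        split_ifs
        · exact Finset.mem_union_left _ (Finset.mem_erase.2 ⟨hbq, hbT⟩)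
        · exact hbT

/-! ### Kraft sums modulo `D - 1` -/

theorem pow_modEq_one {D : ℕ} (hD : 2 ≤ D) (k : ℕ) : D ^ k ≡ 1 [MOD D - 1] := by
  have h : D ≡ 1 [MOD D - 1] :=
    ((Nat.modEq_iff_dvd' (by omega)).2 dvd_rfl).symm
  simpa using h.pow k

/-- Measured in units of `D ^ (-L)`, each codeword contributes a power of `D`, which is `1` modulo
`D - 1`. -/
theorem kraft_modEq {D n : ℕ} (hD : 2 ≤ D) (L : ℕ) (l : Fin n → ℕ) :
    ∑ i, D ^ (L - l i) ≡ n [MOD D - 1] := by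
  have : ∀ s : Finset (Fin n), ∑ i ∈ s, D ^ (L - l i) ≡ s.card [MOD D - 1] := by
    intro s
    induction s using Finset.induction_on with
    | empty => simp; rfl
    | insert a s ha ih =>
      rw [Finset.sum_insert ha, Finset.card_insert_of_notMem ha, add_comm]
      exact ih.add (pow_modEq_one hD _)
  simpa using this Finset.univ

theorem kraft_eq_div {D n : ℕ} (hD : 2 ≤ D) {L : ℕ} {l : Fin n → ℕ} (hl : ∀ i, l i ≤ L) :
    ∑ i, ((D : ℝ) ^ l i)⁻¹ = ((∑ i, D ^ (L - l i) : ℕ) : ℝ) / (D : ℝ) ^ L := by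
  push_cast
  rw [Finset.sum_div]
  refine Finset.sum_congr rfl fun i _ => ?_
  rw [eq_div_iff (by positivity), inv_mul_eq_iff_eq_mul₀ (by positivity), ← pow_add]
  congr 1
  have := hl i
  omega

theorem kraft_le_one_iff {D n : ℕ} (hD : 2 ≤ D) {L : ℕ} {l : Fin n → ℕ} (hl : ∀ i, l i ≤ L) :
    ∑ i, ((D : ℝ) ^ l i)⁻¹ ≤ 1 ↔ ∑ i, D ^ (L - l i) ≤ D ^ L := by
  rw [kraft_eq_div hD hl, div_le_one (by positivity)]
  exact_mod_cast Iff.rfl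

theorem kraft_eq_one_iff {D n : ℕ} (hD : 2 ≤ D) {L : ℕ} {l : Fin n → ℕ} (hl : ∀ i, l i ≤ L) :
    ∑ i, ((D : ℝ) ^ l i)⁻¹ = 1 ↔ ∑ i, D ^ (L - l i) = D ^ L := by
  rw [kraft_eq_div hD hl, div_eq_one_iff_eq (by positivity)]
  exact_mod_cast Iff.rfl

/-- If `n ≡ 1` modulo `D - 1`, then the codewords of a feasible code can be shortened until the
Kraft inequality is an equality. -/
theorem exists_le_kraft_eq_one {D lmin lmax n : ℕ} (hD : 2 ≤ D) (hmod : n ≡ 1 [MOD D - 1])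
    (hmin : D ^ lmin ≤ n) {l : Fin n → ℕ} (hl : IsFeasible D lmin lmax l) :
    ∃ l' : Fin n → ℕ, (∀ i, l' i ≤ l i) ∧ IsFeasible D lmin lmax l' ∧
      ∑ i, ((D : ℝ) ^ l' i)⁻¹ = 1 := by
  induction hs : ∑ i, l i using Nat.strong_induction_on generalizing l with
  | _ s ih =>
  subst hs
  by_cases h1 : ∑ i, ((D : ℝ) ^ l i)⁻¹ = 1
  · exact ⟨l, fun _ => le_rfl, hl, h1⟩
  have hn : 0 < n := lt_of_lt_of_le (by positivity) hmin
  obtain ⟨j, -, hj⟩ := Finset.exists_max_image Finset.univ l ⟨⟨0, hn⟩, Finset.mem_univ _⟩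
  replace hj : ∀ i, l i ≤ l j := fun i => hj i (Finset.mem_univ i)
  have hlt : ∑ i, D ^ (l j - l i) < D ^ l j :=
    lt_of_le_of_ne ((kraft_le_one_iff hD hj).1 hl.2) fun h => h1 ((kraft_eq_one_iff hD hj).2 h)
  -- In units of `D ^ (-l j)` the deficit is a positive multiple of `D - 1`. Shortening the longest
  -- codeword by one replaces `1` by `D`, which costs exactly `D - 1`.
  have hgap : ∑ i, D ^ (l j - l i) + (D - 1) ≤ D ^ l j := by
    have hm : ∑ i, D ^ (l j - l i) ≡ D ^ l j [MOD D - 1] :=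
      ((kraft_modEq hD _ l).trans hmod).trans (pow_modEq_one hD _).symm
    have := Nat.le_of_dvd (by omega) ((Nat.modEq_iff_dvd' hlt.le).1 hm)
    omega
  -- Otherwise all lengths equal `lmin`, and the Kraft sum `n * D ^ (-lmin)` is already at least
  -- `1`.
  have hjmin : lmin < l j := by
    refine lt_of_le_of_ne (hl.1 j).1 fun h => ?_
    have hc : ∀ i, l i = l j := fun i => le_antisymm (hj i) (h ▸ (hl.1 i).1)
    rw [Finset.sum_congr rfl fun i _ => by rw [hc i, Nat.sub_self, pow_zero]] at hlt
    simp only [Finset.sum_const, Finset.card_univ, Fintype.card_fin, smul_eq_mul, mul_one] at hlt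
    rw [← h] at hlt
    omega
  have hle : ∀ i, Function.update l j (l j - 1) i ≤ l i := by
    intro i
    rcases eq_or_ne i j with rfl | hij
    · simp
    · simp [hij]
  have hsum : ∑ i, D ^ (l j - Function.update l j (l j - 1) i) + 1 =
      ∑ i, D ^ (l j - l i) + D := by
    rw [← Finset.add_sum_erase _ _ (Finset.mem_univ j),
      ← Finset.add_sum_erase (a := j) _ (fun i => D ^ (l j - l i)) (Finset.mem_univ j),
      Finset.sum_congr rfl fun i hi => by
        rw [Function.update_of_ne (Finset.ne_of_mem_erase hi)]]
    have : l j - (l j - 1) = 1 := by omega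
    simp only [Function.update_self, this, Nat.sub_self]
    ring
  have hlen : ∑ i, Function.update l j (l j - 1) i < ∑ i, l i := by
    refine Finset.sum_lt_sum (fun i _ => hle i) ⟨j, Finset.mem_univ j, ?_⟩
    simp only [Function.update_self]; omega
  have hge : ∀ i, lmin ≤ Function.update l j (l j - 1) i := by
    intro i
    rcases eq_or_ne i j with rfl | hij
    · simp only [Function.update_self]; omega
    · simpa [hij] using (hl.1 i).1
  obtain ⟨l', hl'1, hl'2, hl'3⟩ := ih _ hlen (l := Function.update l j (l j - 1))
    ⟨fun i => ⟨hge i, (hle i).trans (hl.1 i).2⟩,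
      (kraft_le_one_iff hD fun i => (hle i).trans (hj i)).2 (by omega)⟩ rfl
  exact ⟨l', fun i => (hl'1 i).trans (hle i), hl'2, hl'3⟩

/-- A feasible code leaves room for `d < D - 1` dummy codewords of the maximal length. -/
theorem IsFeasible.append {D lmin lmax n d : ℕ} (hD : 2 ≤ D) (hd : d < D - 1)
    (hmod : n + d ≡ 1 [MOD D - 1]) (hll : lmin ≤ lmax) {l : Fin n → ℕ}
    (hl : IsFeasible D lmin lmax l) :
    IsFeasible D lmin lmax (Fin.append l fun _ : Fin d => lmax) := by
  have hb : ∀ i, lmin ≤ Fin.append l (fun _ : Fin d => lmax) i ∧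
      Fin.append l (fun _ : Fin d => lmax) i ≤ lmax := by
    intro i
    refine Fin.addCases (fun i => ?_) (fun i => ?_) i
    · simpa using hl.1 i
    · simpa using hll
  refine ⟨hb, (kraft_le_one_iff hD fun i => (hb i).2).2 ?_⟩
  have hle := (kraft_le_one_iff hD fun i => (hl.1 i).2).1 hl.2
  have hm : ∑ i, D ^ (lmax - l i) + d ≡ D ^ lmax [MOD D - 1] :=
    (((kraft_modEq hD lmax l).add_right d).trans hmod).trans (pow_modEq_one hD _).symm
  rw [Fin.sum_univ_add]
  simp only [Fin.append_left, Fin.append_right, Nat.sub_self, pow_zero, Finset.sum_const,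
    Finset.card_univ, Fintype.card_fin, smul_eq_mul, mul_one]
  -- An overflow would be a positive multiple of `D - 1`, yet it is at most `d`, because the
  -- original code was feasible.
  by_contra! hlt
  have := Nat.le_of_dvd (by omega) ((Nat.modEq_iff_dvd' hlt.le).1 hm.symm)
  omega

theorem isFeasible_const {D lmin lmax n : ℕ} (hD : 2 ≤ D) (hll : lmin ≤ lmax)
    (hn : n ≤ D ^ lmax) : IsFeasible D lmin lmax fun _ : Fin n => lmax :=
  ⟨fun _ => ⟨hll, le_rfl⟩, (kraft_le_one_iff hD fun _ => le_rfl).2 (by simpa using hn)⟩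

/-- Otherwise `D ^ (lmax + 1) ≤ n + d < D ^ lmax + (D - 1)`, which is impossible since `D ^ lmax *
(D - 1) ≥ D - 1`. -/
theorem lmin_le_lmax {D lmin lmax n d : ℕ} (hD : 2 ≤ D) (hd : d < D - 1)
    (hmin : D ^ lmin ≤ n + d) (hmax : n ≤ D ^ lmax) : lmin ≤ lmax := by
  by_contra! h
  have h1 : D ^ (lmax + 1) ≤ D ^ lmin := Nat.pow_le_pow_right (by omega) h
  have h2 : 1 ≤ D ^ lmax := Nat.one_le_pow _ _ (by omega)
  obtain ⟨E, rfl⟩ : ∃ E, D = E + 1 := ⟨D - 1, by omega⟩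
  have h3 : E ≤ (E + 1) ^ lmax * E := Nat.le_mul_of_pos_left _ h2
  rw [pow_succ, mul_add, mul_one] at h1
  omega

/-! ### Nodesets, their widths and weights -/

section Nodes

variable {n : ℕ}

theorem mem_nodeset {lmin : ℕ} {l : Fin n → ℕ} {v : Fin n × ℕ} :
    v ∈ nodeset lmin l ↔ lmin + 1 ≤ v.2 ∧ v.2 ≤ l v.1 := by
  obtain ⟨i, k⟩ := v
  simp [nodeset]

theorem mem_nodeGrid {lmin lmax : ℕ} {v : Fin n × ℕ} :
    v ∈ nodeGrid n lmin lmax ↔ lmin + 1 ≤ v.2 ∧ v.2 ≤ lmax := by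
  simp [nodeGrid]

theorem nodeset_subset {lmin lmax : ℕ} {l : Fin n → ℕ} (hl : ∀ i, l i ≤ lmax) :
    nodeset lmin l ⊆ nodeGrid n lmin lmax := fun v hv => by
  rw [mem_nodeset] at hv
  exact mem_nodeGrid.2 ⟨hv.1, hv.2.trans (hl _)⟩

theorem sum_nodeset (lmin : ℕ) (l : Fin n → ℕ) (f : Fin n × ℕ → ℝ) :
    ∑ v ∈ nodeset lmin l, f v = ∑ i, ∑ k ∈ Finset.Icc (lmin + 1) (l i), f (i, k) := by
  rw [nodeset, Finset.sum_biUnion]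
  · refine Finset.sum_congr rfl fun i _ => ?_
    rw [Finset.sum_product, Finset.sum_singleton]
  · intro i _ j _ hij
    simp only [Function.onFun, Finset.disjoint_left, Finset.mem_product, Finset.mem_singleton]
    rintro v ⟨h, _⟩ ⟨h', _⟩
    exact hij (h.symm.trans h')

theorem sum_Icc_inv_pow {D : ℕ} (hD : 2 ≤ D) {lmin L : ℕ} (h : lmin ≤ L) :
    ∑ k ∈ Finset.Icc (lmin + 1) L, ((D : ℝ) ^ k)⁻¹ =
      (((D : ℝ) ^ lmin)⁻¹ - ((D : ℝ) ^ L)⁻¹) / ((D : ℝ) - 1) := by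
  have hD1 : (D : ℝ) - 1 ≠ 0 := by
    have : (2 : ℝ) ≤ D := by exact_mod_cast hD
    linarith
  induction L, h using Nat.le_induction with
  | base => simp
  | succ L hL ih =>
    rw [Finset.sum_Icc_succ_top (by omega), ih, pow_succ]
    field_simp
    ring

theorem sum_nodeWidth_nodeset {D : ℕ} (hD : 2 ≤ D) {lmin : ℕ} {l : Fin n → ℕ}
    (hl : ∀ i, lmin ≤ l i) :
    ∑ v ∈ nodeset lmin l, nodeWidth D v =
      (n * ((D : ℝ) ^ lmin)⁻¹ - ∑ i, ((D : ℝ) ^ l i)⁻¹) / ((D : ℝ) - 1) := by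
  rw [sum_nodeset]
  simp only [nodeWidth]
  rw [Finset.sum_congr rfl fun i _ => sum_Icc_inv_pow hD (hl i), ← Finset.sum_div,
    Finset.sum_sub_distrib]
  simp

/-- The geometric sums of the columns add up to `n * D ^ (-lmin)` minus the Kraft sum, over `D - 1`;
the target is this expression with Kraft sum `1`. -/
theorem sum_nodeWidth_eq_targetWidth_iff {D : ℕ} (hD : 2 ≤ D) {lmin : ℕ} {l : Fin n → ℕ}
    (hl : ∀ i, lmin ≤ l i) :
    ∑ v ∈ nodeset lmin l, nodeWidth D v = targetWidth D lmin n ↔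
      ∑ i, ((D : ℝ) ^ l i)⁻¹ = 1 := by
  have hD1 : (D : ℝ) - 1 ≠ 0 := by
    have : (2 : ℝ) ≤ D := by exact_mod_cast hD
    linarith
  have ht : targetWidth D lmin n = (n * ((D : ℝ) ^ lmin)⁻¹ - 1) / ((D : ℝ) - 1) := by
    rw [targetWidth]; field_simp
  rw [ht, sum_nodeWidth_nodeset hD hl, div_left_inj' hD1, sub_right_inj]

/-- Each column telescopes down to `p i * φ 0`. -/
theorem sum_nodeWeight_nodeset (φ : ℝ → ℝ) {lmin : ℕ} (p : Fin n → ℝ) {l : Fin n → ℕ}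
    (hl : ∀ i, lmin ≤ l i) :
    ∑ v ∈ nodeset lmin l, nodeWeight φ lmin p v = penalty φ lmin p l - φ 0 * ∑ i, p i := by
  rw [sum_nodeset, penalty, Finset.mul_sum, ← Finset.sum_sub_distrib]
  refine Finset.sum_congr rfl fun i _ => ?_
  have h := hl i
  generalize l i = L at h
  induction L, h using Nat.le_induction with
  | base => simp; ring
  | succ L hL ih =>
    rw [Finset.sum_Icc_succ_top (by omega), ih]
    simp only [nodeWeight]
    push_cast
    rw [show (L : ℝ) + 1 - lmin - 1 = L - lmin by ring]
    ring

/-- A set of nodes that contains with every node the node above it is a nodeset. -/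
theorem exists_eq_nodeset {lmin lmax : ℕ} (hll : lmin ≤ lmax) {N : Finset (Fin n × ℕ)}
    (hN : N ⊆ nodeGrid n lmin lmax)
    (hdown : ∀ i k, lmin + 1 ≤ k → (i, k + 1) ∈ N → (i, k) ∈ N) :
    ∃ l : Fin n → ℕ, (∀ i, lmin ≤ l i ∧ l i ≤ lmax) ∧ N = nodeset lmin l := by
  -- The maximum with `lmin` covers empty columns, for which the supremum is `0`.
  refine ⟨fun i => max lmin ((N.filter fun v => v.1 = i).sup Prod.snd),
    fun i => ⟨le_max_left _ _, max_le hll (Finset.sup_le fun v hv =>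
      (mem_nodeGrid.1 (hN (Finset.mem_filter.1 hv).1)).2)⟩, ?_⟩
  ext ⟨i, k⟩
  rw [mem_nodeset]
  constructor
  · intro h
    exact ⟨(mem_nodeGrid.1 (hN h)).1, le_max_of_le_right
      (Finset.le_sup (f := Prod.snd) (Finset.mem_filter.2 ⟨h, rfl⟩))⟩
  · rintro ⟨h1, h2⟩
    simp only at h1 h2
    have h3 : k ≤ (N.filter fun v => v.1 = i).sup Prod.snd := by
      rcases le_max_iff.1 h2 with h | h
      · omega
      · exact h
    obtain ⟨⟨i', m⟩, hm, hkm⟩ := (Finset.le_sup_iff (by simp; omega)).1 h3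
    obtain ⟨hmN, rfl⟩ := Finset.mem_filter.1 hm
    simp only at hkm hmN ⊢
    clear h2 h3 hm
    induction m, hkm using Nat.le_induction with
    | base => exact hmN
    | succ m hkm ih => exact ih (hdown _ _ (by omega) hmN)

variable {D lmin lmax : ℕ} {φ : ℝ → ℝ} {p : Fin n → ℝ} {num : Fin n × ℕ → ℤ}

theorem injOn_nodeItem {G : Finset (Fin n × ℕ)}
    (hnum : Set.InjOn num (G : Set (Fin n × ℕ))) :
    Set.InjOn (fun v => (⟨num v, nodeWidth D v, nodeWeight φ lmin p v⟩ : Item))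
      (G : Set (Fin n × ℕ)) :=
  fun _ ha _ hb h => hnum ha hb (congrArg Item.index h)

theorem nodeItems_mono {N G : Finset (Fin n × ℕ)} (h : N ⊆ G) :
    nodeItems D φ lmin p num N ⊆ nodeItems D φ lmin p num G :=
  Finset.image_subset_image h

theorem exists_eq_nodeItems {G : Finset (Fin n × ℕ)} {S : Finset Item}
    (hS : S ⊆ nodeItems D φ lmin p num G) : ∃ N ⊆ G, S = nodeItems D φ lmin p num N := by
  obtain ⟨N, hN, h⟩ := Finset.subset_image_iff.1 hS
  exact ⟨N, hN, h.symm⟩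

theorem totalWidth_nodeItems {N : Finset (Fin n × ℕ)}
    (hnum : Set.InjOn num (N : Set (Fin n × ℕ))) :
    totalWidth (nodeItems D φ lmin p num N) = ∑ v ∈ N, nodeWidth D v :=
  Finset.sum_image (injOn_nodeItem hnum)

theorem totalWeight_nodeItems {N : Finset (Fin n × ℕ)}
    (hnum : Set.InjOn num (N : Set (Fin n × ℕ))) :
    totalWeight (nodeItems D φ lmin p num N) = ∑ v ∈ N, nodeWeight φ lmin p v :=
  Finset.sum_image (injOn_nodeItem hnum)

theorem isCoinSystem_nodeItems {G : Finset (Fin n × ℕ)}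
    (hnum : Set.InjOn num (G : Set (Fin n × ℕ))) :
    IsCoinSystem D (nodeItems D φ lmin p num G) := by
  constructor
  · intro a ha
    obtain ⟨v, -, rfl⟩ := Finset.mem_image.1 ha
    exact ⟨-(v.2 : ℤ), by simp [nodeWidth]⟩
  · intro a ha b hb hab
    obtain ⟨v, hv, rfl⟩ := Finset.mem_image.1 (Finset.mem_coe.1 ha)
    obtain ⟨w, hw, rfl⟩ := Finset.mem_image.1 (Finset.mem_coe.1 hb)
    rw [hnum hv hw hab]

theorem nodeWeight_nonneg (hp : ∀ i, 0 ≤ p i) (hmono : MonotoneOn φ (Set.Ici 0))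
    {v : Fin n × ℕ} (hv : v ∈ nodeGrid n lmin lmax) : 0 ≤ nodeWeight φ lmin p v := by
  have h : (lmin : ℝ) + 1 ≤ v.2 := by exact_mod_cast (mem_nodeGrid.1 hv).1
  rw [nodeWeight, ← mul_sub]
  refine mul_nonneg (hp _) (sub_nonneg.2 (hmono ?_ ?_ ?_))
  · simp only [Set.mem_Ici]; linarith
  · simp only [Set.mem_Ici]; linarith
  · linarith

/-- Midpoint convexity of `φ` at three consecutive arguments. -/
theorem nodeWeight_le_succ (hp : ∀ i, 0 ≤ p i) (hconv : ConvexOn ℝ (Set.Ici 0) φ)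
    {i : Fin n} {k : ℕ} (hk : lmin + 1 ≤ k) :
    nodeWeight φ lmin p (i, k) ≤ nodeWeight φ lmin p (i, k + 1) := by
  have hk : (lmin : ℝ) + 1 ≤ k := by exact_mod_cast hk
  simp only [nodeWeight]
  push_cast
  rw [← mul_sub, ← mul_sub]
  refine mul_le_mul_of_nonneg_left ?_ (hp i)
  have h1 : (k : ℝ) - lmin - 1 ∈ Set.Ici (0 : ℝ) := by simp only [Set.mem_Ici]; linarith
  have h2 : (k : ℝ) + 1 - lmin ∈ Set.Ici (0 : ℝ) := by simp only [Set.mem_Ici]; linarith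
  have h := hconv.2 h1 h2 (by norm_num : (0 : ℝ) ≤ 1 / 2) (by norm_num : (0 : ℝ) ≤ 1 / 2)
    (by norm_num)
  simp only [smul_eq_mul] at h
  rw [show 1 / 2 * ((k : ℝ) - lmin - 1) + 1 / 2 * ((k : ℝ) + 1 - lmin) = k - lmin by ring] at h
  rw [show (k : ℝ) + 1 - lmin - 1 = k - lmin by ring]
  linarith

/-- The congruence makes `(n - D ^ lmin) / (D - 1)` an integer. This supplies the divisibility
condition in the weight clause of `IsClosedUnder` for every node. -/
theorem targetWidth_eq_intCast_mul (hD : 2 ≤ D) (hmod : n ≡ 1 [MOD D - 1]) {k : ℕ}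
    (hk : lmin ≤ k) : ∃ z : ℤ, targetWidth D lmin n = z * ((D : ℝ) ^ k)⁻¹ := by
  have hD1 : (D : ℝ) - 1 ≠ 0 := by
    have : (2 : ℝ) ≤ D := by exact_mod_cast hD
    linarith
  obtain ⟨z, hz⟩ := (hmod.trans (pow_modEq_one hD lmin).symm).symm.dvd
  rw [Nat.cast_sub (by omega : 1 ≤ D)] at hz
  obtain ⟨m, rfl⟩ := Nat.exists_eq_add_of_le hk
  have hz' : (n : ℝ) - (D : ℝ) ^ lmin = (D - 1) * z := by exact_mod_cast hz
  refine ⟨z * D ^ m, ?_⟩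
  rw [targetWidth, hz', mul_div_cancel_left₀ _ hD1, pow_add]
  push_cast
  field_simp

/-- The result of Package-Merge contains with every node the node above it. -/
theorem IsClosedUnder.node_mem (hD : 2 ≤ D) (hmod : n ≡ 1 [MOD D - 1]) (hp : ∀ i, 0 ≤ p i)
    (hconv : ConvexOn ℝ (Set.Ici 0) φ) (hmono : MonotoneOn φ (Set.Ici 0))
    (hnum : Set.InjOn num (nodeGrid n lmin lmax : Set (Fin n × ℕ))) {N : Finset (Fin n × ℕ)}
    (hN : N ⊆ nodeGrid n lmin lmax)
    (hcl : IsClosedUnder D (nodeItems D φ lmin p num (nodeGrid n lmin lmax))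
      (targetWidth D lmin n) (nodeItems D φ lmin p num N))
    {i : Fin n} {k : ℕ} (hk : lmin + 1 ≤ k) (h : (i, k + 1) ∈ N) : (i, k) ∈ N := by
  have hb := mem_nodeGrid.1 (hN h)
  have ha : (i, k) ∈ nodeGrid n lmin lmax := mem_nodeGrid.2 ⟨hk, (Nat.le_succ k).trans hb.2⟩
  have hmem := hcl.of_weight_le _ (Finset.mem_image_of_mem _ ha) _
    (Finset.mem_image_of_mem _ h) ?_ (targetWidth_eq_intCast_mul hD hmod (by omega)) ?_
  · obtain ⟨v, hv, hva⟩ := Finset.mem_image.1 hmem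
    rwa [← injOn_nodeItem hnum (hN hv) ha hva]
  · simp only [nodeWidth, pow_succ]
    field_simp
  -- Any `T` containing the lower node weighs at least as much as that node, since all weights are
  -- nonnegative.
  · intro T hT hbT _
    refine (nodeWeight_le_succ hp hconv hk).trans ?_
    refine Finset.single_le_sum (f := Item.weight) (fun x hx => ?_) hbT
    obtain ⟨v, hv, rfl⟩ := Finset.mem_image.1 (hT hx)
    exact nodeWeight_nonneg hp hmono hv

end Nodes

/-! ### Monotonicity of the penalty and dummy symbols -/

theorem penalty_le_penalty {φ : ℝ → ℝ} {lmin n : ℕ} {p : Fin n → ℝ} (hp : ∀ i, 0 ≤ p i)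
    (hmono : MonotoneOn φ (Set.Ici 0)) {l l' : Fin n → ℕ} (hl : ∀ i, lmin ≤ l i)
    (hll' : ∀ i, l i ≤ l' i) : penalty φ lmin p l ≤ penalty φ lmin p l' := by
  refine Finset.sum_le_sum fun i _ => mul_le_mul_of_nonneg_left ?_ (hp i)
  have h1 : (lmin : ℝ) ≤ l i := by exact_mod_cast hl i
  have h2 : (l i : ℝ) ≤ l' i := by exact_mod_cast hll' i
  refine hmono ?_ ?_ ?_
  · simp only [Set.mem_Ici]; linarith
  · simp only [Set.mem_Ici]; linarith
  · linarith

theorem withDummies_nonneg {n : ℕ} {p : Fin n → ℝ} (hp : ∀ i, 0 ≤ p i) (d : ℕ) (i : Fin (n + d)) :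
    0 ≤ withDummies p d i := by
  refine Fin.addCases (fun i => ?_) (fun i => ?_) i
  · simpa [withDummies] using hp i
  · simp [withDummies]

theorem penalty_withDummies (φ : ℝ → ℝ) (lmin : ℕ) {n d : ℕ} (p : Fin n → ℝ)
    (l : Fin (n + d) → ℕ) :
    penalty φ lmin (withDummies p d) l = penalty φ lmin p fun i => l (Fin.castAdd d i) := by
  simp [penalty, withDummies, Fin.sum_univ_add]

/-- Dropping the dummy symbols preserves optimality. -/
theorem IsOptimal.of_withDummies {D lmin lmax n d : ℕ} (hD : 2 ≤ D) (hd : d < D - 1)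
    (hmod : n + d ≡ 1 [MOD D - 1]) (hll : lmin ≤ lmax) {φ : ℝ → ℝ} {p : Fin n → ℝ}
    {l : Fin (n + d) → ℕ} (hl : IsOptimal D lmin lmax φ (withDummies p d) l) :
    IsOptimal D lmin lmax φ p fun i => l (Fin.castAdd d i) := by
  refine ⟨⟨fun i => hl.1.1 _, ?_⟩, fun l' hl' => ?_⟩
  · have h := hl.1.2
    rw [Fin.sum_univ_add] at h
    have : 0 ≤ ∑ i : Fin d, ((D : ℝ) ^ l (Fin.natAdd n i))⁻¹ :=
      Finset.sum_nonneg fun i _ => by positivity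
    linarith
  · have h := hl.2 _ (hl'.append hD hd hmod hll)
    rw [penalty_withDummies, penalty_withDummies] at h
    simpa using h

end BoundedCoding

/-! ### The reduction -/

open BoundedCoding in
theorem theorem2 (D lmin lmax n d : ℕ) (hD : 2 ≤ D)
    (hd : d < D - 1) (hmod : n + d ≡ 1 [MOD D - 1])
    (hmin : D ^ lmin ≤ n + d) (hmax : n ≤ D ^ lmax)
    (p : Fin n → ℝ) (hp : ∀ i, 0 ≤ p i)
    (φ : ℝ → ℝ) (hconv : ConvexOn ℝ (Set.Ici 0) φ) (hmono : MonotoneOn φ (Set.Ici 0))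
    (num : Fin (n + d) × ℕ → ℤ)
    (hnum : Set.InjOn num (nodeGrid (n + d) lmin lmax : Set (Fin (n + d) × ℕ))) :
    ∃ N ⊆ nodeGrid (n + d) lmin lmax,
      packageMerge D hD
          (nodeItems D φ lmin (withDummies p d) num (nodeGrid (n + d) lmin lmax))
          (targetWidth D lmin (n + d)) =
        some (nodeItems D φ lmin (withDummies p d) num N) ∧
      IsCoinSolution
          (nodeItems D φ lmin (withDummies p d) num (nodeGrid (n + d) lmin lmax))
          (targetWidth D lmin (n + d))
          (nodeItems D φ lmin (withDummies p d) num N) ∧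
      IsLeast
          {x : ℝ | ∃ l : Fin (n + d) → ℕ, IsFeasible D lmin lmax l ∧
            x = penalty φ lmin (withDummies p d) l - φ 0 * ∑ i, withDummies p d i}
          (∑ v ∈ N, nodeWeight φ lmin (withDummies p d) v) ∧
      ∃ lN : Fin (n + d) → ℕ,
        N = nodeset lmin lN ∧
        IsOptimal D lmin lmax φ (withDummies p d) lN ∧
        IsOptimal D lmin lmax φ p (fun i : Fin n => lN (Fin.castAdd d i)) := by
  have hll := lmin_le_lmax hD hd hmin hmax
  have hq := withDummies_nonneg hp d
  have hsys : IsCoinSystem D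
      (nodeItems D φ lmin (withDummies p d) num (nodeGrid (n + d) lmin lmax)) :=
    isCoinSystem_nodeItems hnum
  -- Every code competes with the coin solution: shortened to Kraft equality, it becomes an
  -- admissible coin collection whose weight is bounded by the normalized penalty of the original
  -- code.
  have hle : ∀ l : Fin (n + d) → ℕ, IsFeasible D lmin lmax l →
      ∃ l' : Fin (n + d) → ℕ, IsFeasible D lmin lmax l' ∧
        nodeset lmin l' ⊆ nodeGrid (n + d) lmin lmax ∧
        totalWidth (nodeItems D φ lmin (withDummies p d) num (nodeset lmin l')) =
          targetWidth D lmin (n + d) ∧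
        totalWeight (nodeItems D φ lmin (withDummies p d) num (nodeset lmin l')) ≤
          penalty φ lmin (withDummies p d) l - φ 0 * ∑ i, withDummies p d i := by
    intro l hl
    obtain ⟨l', hl'l, hl', hk⟩ := exists_le_kraft_eq_one hD hmod hmin hl
    have hsub := nodeset_subset (lmin := lmin) fun i => (hl'.1 i).2
    have hinj := hnum.mono (Finset.coe_subset.2 hsub)
    have hlow := fun i => (hl'.1 i).1
    refine ⟨l', hl', hsub, ?_, ?_⟩
    · rw [totalWidth_nodeItems hinj, sum_nodeWidth_eq_targetWidth_iff hD hlow, hk]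
    · rw [totalWeight_nodeItems hinj, sum_nodeWeight_nodeset φ _ hlow]
      exact sub_le_sub_right (penalty_le_penalty hq hmono hlow hl'l) _
  obtain ⟨S, hS, hsol⟩ := packageMerge_isCoinSolution hD hsys (by
    -- The coin problem is solvable: give all `n` symbols length `lmax`, append the dummies, and
    -- shorten.
    obtain ⟨l, -, hsub, hw, -⟩ :=
      hle _ ((isFeasible_const hD hll hmax).append hD hd hmod hll)
    exact ⟨_, nodeItems_mono hsub, hw⟩)
  obtain ⟨N, hN, rfl⟩ := exists_eq_nodeItems hsol.1
  have hcl := packageMerge_isClosedUnder hD hsys hS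
  obtain ⟨l, hl, rfl⟩ := exists_eq_nodeset hll hN fun i k hk h =>
    hcl.node_mem hD hmod hq hconv hmono hnum hN hk h
  have hinj := hnum.mono (Finset.coe_subset.2 hN)
  have hlow := fun i => (hl i).1
  have hfeas : IsFeasible D lmin lmax l := by
    refine ⟨hl, le_of_eq ?_⟩
    rw [← sum_nodeWidth_eq_targetWidth_iff hD hlow, ← totalWidth_nodeItems hinj]
    exact hsol.2.1
  have hopt : ∀ l', IsFeasible D lmin lmax l' →
      ∑ v ∈ nodeset lmin l, nodeWeight φ lmin (withDummies p d) v ≤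
        penalty φ lmin (withDummies p d) l' - φ 0 * ∑ i, withDummies p d i := by
    intro l' hl'
    obtain ⟨l'', -, hsub, hw, hwt⟩ := hle l' hl'
    rw [← totalWeight_nodeItems hinj]
    exact (hsol.2.2 _ (nodeItems_mono hsub) hw).trans hwt
  have hlN : IsOptimal D lmin lmax φ (withDummies p d) l := by
    refine ⟨hfeas, fun l' hl' => ?_⟩
    have h := hopt l' hl'
    rw [sum_nodeWeight_nodeset φ _ hlow] at h
    linarith
  refine ⟨_, hN, hS, hsol, ⟨⟨l, hfeas, sum_nodeWeight_nodeset φ _ hlow⟩, ?_⟩, l, rfl, hlN,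
    hlN.of_withDummies hD hd hmod hll⟩
  rintro _ ⟨l', hl', rfl⟩
  exact hopt l' hl'
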